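/- **Setting.** A $k$-player game $G$ ($k\ge 1$) has finite question sets $\mathscr X^1,\dots,\mathscr X^k$ and finite answer sets $\mathscr A^1,\dots,\mathscr A^k$, a probability distribution $\mu$ on $\mathscr X=\mathscr X^1\times\cdots\times\mathscr X^k$ and a predicate $V:\mathscr X\times\mathscr A\to\{0,1\}$, where $\mathscr A=\mathscr A^1\times\cdots\times\mathscr A^k$. Its value $\mathrm{val}(G)$ is the maximum, over functions $f^t:\mathscr X^t\to\mathscr A^t$ ($t\in[k]$), of $\Pr_{x\sim\mu}[V(x,(f^t(x^t))_t)=1]$. In the $n$-fold parallel repetition $G^{\otimes n}$, $n$ question tuples are drawn independently from $\mu$, player $t$ sees the $t$-th question of all of them and gives $n$ answers, and the players win iff they win in each of the $n$ coordinates. The $(k-1)$-connection graph $H_G$ is the weighted graph with vertex set $\mathscr X$ in which $\rho(x,x')$ is the probability of obtaining the pair $(x,x')$ when $x$ is drawn from $\mu$, $t\in[k]$ uniformly and independently, and $x'$ from $\mu$ conditioned on $x'^s=x^s$ for all $s\ne t$. The weight of a vertex is $\rho(x)=\sum_{x'}\rho(x,x')=\mu(x)$. Put $$\lambda(H_G)=\inf_{r,\,g}\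 \frac{\sum_{x,x'}\rho(x,x')\,\|g(x)-g(x')\|^2}{\sum_x\rho(x)\,\|g(x)-\overline g\|^2},\qquad \overline g=\sum_x\rho(x)g(x),$$ where $r$ ranges over $\mathbb N$ and $g$ over the functions $\mathscr X\to\mathbb R^r$ for which the denominator is non-zero ($\lambda(H_G)=\infty$ if there are none). Let $\rho_{\min}$ be the minimum of $\rho(x,x')$ over all pairs $(x,x')$ (including $x=x'$) with $\rho(x,x')>0$. The game $G$ is *connected* if the graph on the vertices with $\rho(x)\neq 0$, with an edge between distinct $x,x'$ when $\rho(x,x')>0$, is connected. It is *free* if $\mu$ is a product distribution $\mu^1\times\cdots\times\mu^k$. For $0<\alpha<1$, the game $G$ is *$\alpha$-anchored* if it arises from some $k$-player game $G_0$ with the same answer sets as follows: the question sets of $G_0$ are extended by a new symbol $\bot$; a tuple is drawn as in $G_0$, and each of its entries is independently replaced by $\bot$ with probability $\alpha$; the players win if some question is $\bot$, and otherwise they win iff they win in $G_0$. **Statement.** There is a universal constant $c>0$ such that the following holds. Let $G$ be a $k$-player game with $|\mathscr A|\ge 2$ and $\mathrm{val}(G)\le 1-\varepsilon$, where $\varepsilon>0$,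 and let $n\ge \frac{\log (4/\varepsilon)}{\varepsilon^5\lambda(H_G)^2}$ be an integer, $n \ge 0$. 1. If $G$ is free, then $\displaystyle \mathrm{val}(G^{\otimes n})\le\exp\left(-\frac{c\,\varepsilon^5\,n}{k^2\log|\mathscr A|}\right)$. 2. If $G$ is $\alpha$-anchored, $0<\alpha<1$, then $\displaystyle \mathrm{val}(G^{\otimes n})\le\exp\left(-\frac{c\,\alpha^{2k}\,\varepsilon^5\,n}{64\,k^2\log|\mathscr A|}\right)$. 3. If $G$ is connected, then $\displaystyle \mathrm{val}(G^{\otimes n})\le\exp\left(-\frac{c\,\rho_{\min}^2\,\varepsilon^5\,n}{\log|\mathscr A|}\right)$. Moreover, for all $k \ge 1$, every $\alpha$-anchored $k$-player game with $0<\alpha<1$ satisfies $\lambda(H_G)\ge \alpha^k/(8k)$, and if $\mu$ is the uniform distribution on a set $S\subseteq\mathscr X$, then $\rho_{\min}\ge (k|S|^2)^{-1}$. -/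

import Mathlib

open scoped ENNReal

universe u v

/-- A `k`-player one-round game with finite question sets `X t` and answer sets `A t`: a probability
distribution `μ` on question tuples and a predicate `V` on questions and answers. -/
structure Game (k : ℕ) (X : Fin k → Type u) (A : Fin k → Type v) [∀ t, Fintype (X t)] where
  μ : (∀ t, X t) → ℝ
  μ_nonneg : ∀ x, 0 ≤ μ x
  μ_sum : ∑ x, μ x = 1
  V : (∀ t, X t) → (∀ t, A t) → Bool

/-! ### Weighted graphs, given by a weight function on ordered pairs of vertices -/

namespace WGraph

variable {W : Type u} [Fintype W]

/-- The weight `ρ(u) = ∑ v, ρ(u, v)` of a vertex. -/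
noncomputable def weight (ρ : W → W → ℝ) (a : W) : ℝ := ∑ b, ρ a b

/-- The mean of a vector-valued function on the vertices. -/
noncomputable def mean (ρ : W → W → ℝ) {r : ℕ} (g : W → EuclideanSpace ℝ (Fin r)) :
    EuclideanSpace ℝ (Fin r) := ∑ a, weight ρ a • g a

/-- `∑ u, ρ(u) ‖g(u) - mean g‖ ^ 2`. -/
noncomputable def variance (ρ : W → W → ℝ) {r : ℕ} (g : W → EuclideanSpace ℝ (Fin r)) : ℝ :=
  ∑ a, weight ρ a * ‖g a - mean ρ g‖ ^ 2

/-- `∑ u v, ρ(u, v) ‖g(u) - g(v)‖ ^ 2`, over ordered pairs. -/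
noncomputable def energy (ρ : W → W → ℝ) {r : ℕ} (g : W → EuclideanSpace ℝ (Fin r)) : ℝ :=
  ∑ a, ∑ b, ρ a b * ‖g a - g b‖ ^ 2

/-- The expansion `λ` of a weighted graph: the infimum of the quotient energy / variance over all
vector-valued functions of non-zero variance. It is `⊤` if there is no such function, that is, if
the graph has a single vertex of non-zero weight. -/
noncomputable def lam (ρ : W → W → ℝ) : ℝ≥0∞ :=
  ⨅ (r : ℕ) (g : W → EuclideanSpace ℝ (Fin r)) (_ : 0 < variance ρ g),
    ENNReal.ofReal (energy ρ g / variance ρ g)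

/-- The underlying simple graph on the vertices of non-zero weight. -/
def support (ρ : W → W → ℝ) : SimpleGraph {a : W // weight ρ a ≠ 0} :=
  SimpleGraph.fromRel fun a b => 0 < ρ a b

/-- The smallest non-zero weight of a pair (loops `u = v` included); the set is finite. -/
noncomputable def minWeight (ρ : W → W → ℝ) : ℝ := sInf {s | 0 < s ∧ ∃ a b, s = ρ a b}

end WGraph

namespace Game

variable {k : ℕ} {X : Fin k → Type u} {A : Fin k → Type v} [∀ t, Fintype (X t)]

/-! ### Value and parallel repetition -/

/-- The winning probability of the (deterministic) strategy `f`. -/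
noncomputable def winProb (G : Game k X A) (f : ∀ t, X t → A t) : ℝ :=
  ∑ x, G.μ x * (if G.V x (fun t => f t (x t)) = true then 1 else 0)

/-- The value of a game. -/
noncomputable def val (G : Game k X A) : ℝ := ⨆ f : ∀ t, X t → A t, G.winProb f

/-- The `n`-fold parallel repetition of a game. -/
noncomputable def rep (G : Game k X A) (n : ℕ) :
    Game k (fun t => Fin n → X t) (fun t => Fin n → A t) where
  μ x := ∏ i, G.μ (fun t => x t i)
  μ_nonneg x := Finset.prod_nonneg fun i _ => G.μ_nonneg _
  μ_sum := by
    have h : ∑ y : Fin n → ∀ t, X t, ∏ i, G.μ (y i) = 1 := by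
      rw [← Fintype.prod_sum (fun (_ : Fin n) (x : ∀ t, X t) => G.μ x)]
      simp [G.μ_sum]
    rw [← h]
    exact Fintype.sum_equiv (Equiv.piComm fun (t : Fin k) (_ : Fin n) => X t) _ _ fun x => rfl
  V x a := decide (∀ i, G.V (fun t => x t i) (fun t => a t i) = true)

/-! ### The connection graph -/

/-- The marginal probability `P(x^{-t})` of the questions of all players but `t`. -/
noncomputable def margExcept (G : Game k X A) (t : Fin k) (x : ∀ t, X t) : ℝ :=
  ∑ y : X t, G.μ (Function.update x t y)

/-- The conditional probability `P(X^t = y | x^{-t})` (`0` if `P(x^{-t}) = 0`). -/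
noncomputable def condProb (G : Game k X A) (t : Fin k) (x : ∀ t, X t) (y : X t) : ℝ :=
  G.μ (Function.update x t y) / G.margExcept t x

open scoped Classical in
/-- The weight function of the `(k-1)`-connection graph. If `x ≠ x'`, there is at most one `t` with
`x^{-t} = x'^{-t}`, so at most one summand in the second case is non-zero. -/
noncomputable def rho (G : Game k X A) (x x' : ∀ t, X t) : ℝ :=
  if x = x' then 1 / (k : ℝ) * (G.μ x * ∑ t, G.condProb t x (x t))
  else ∑ t, if ∀ s, s ≠ t → x s = x' s then
    1 / (k : ℝ) * (G.margExcept t x * G.condProb t x (x t) * G.condProb t x (x' t)) else 0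

/-- The expansion of the `(k-1)`-connection graph of the game. -/
noncomputable def lam (G : Game k X A) : ℝ≥0∞ := WGraph.lam G.rho

/-- The `(k-1)`-connection graph is connected (on its vertices of non-zero weight). -/
def IsConnected (G : Game k X A) : Prop := (WGraph.support G.rho).Connected

/-- The smallest non-zero weight `ρ_min` in the `(k-1)`-connection graph. -/
noncomputable def rhoMin (G : Game k X A) : ℝ := WGraph.minWeight G.rho

/-! ### Classes of games -/

/-- Free games: the questions of the players are independent. -/
def IsFree (G : Game k X A) : Prop :=
  ∃ ν : ∀ t, X t → ℝ, (∀ t y, 0 ≤ ν t y) ∧ (∀ t, ∑ y, ν t y = 1) ∧ ∀ x, G.μ x = ∏ t, ν t (x t)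

/-- The question distribution is uniform on the set `S`. -/
def IsUniformOn (G : Game k X A) (S : Finset (∀ t, X t)) : Prop :=
  (∀ x ∈ S, G.μ x = 1 / (S.card : ℝ)) ∧ ∀ x, x ∉ S → G.μ x = 0

open scoped Classical in
/-- The probability that the question `y` becomes `y'` when it is replaced by the anchor `none` with
probability `α` and kept otherwise. -/
noncomputable def anchorProb {Y : Type u} (α : ℝ) (y : Y) (y' : Option Y) : ℝ :=
  if y' = none then α else if y' = some y then 1 - α else 0

theorem anchorProb_nonneg {Y : Type u} {α : ℝ} (h0 : 0 ≤ α) (h1 : α ≤ 1) (y : Y) (y' : Option Y) :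
    0 ≤ anchorProb α y y' := by
  unfold anchorProb
  split_ifs <;> linarith

theorem anchorProb_sum {Y : Type u} [Fintype Y] (α : ℝ) (y : Y) :
    ∑ y', anchorProb α y y' = 1 := by
  classical
  rw [Fintype.sum_option]
  simp [anchorProb]

/-- The `α`-anchored game of `G`: every question is replaced, independently, by the anchor `none`
with probability `α`, and the players win if some question is the anchor. -/
noncomputable def anchored (G : Game k X A) (α : ℝ) (h0 : 0 ≤ α) (h1 : α ≤ 1) :
    Game k (fun t => Option (X t)) A where
  μ x' := ∑ x, G.μ x * ∏ t, anchorProb α (x t) (x' t)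
  μ_nonneg x' := Finset.sum_nonneg fun x _ =>
    mul_nonneg (G.μ_nonneg x) (Finset.prod_nonneg fun t _ => anchorProb_nonneg h0 h1 _ _)
  μ_sum := by
    rw [Finset.sum_comm]
    have h : ∀ x : ∀ t, X t, ∑ x' : ∀ t, Option (X t), ∏ t, anchorProb α (x t) (x' t) = 1 := by
      intro x
      rw [← Fintype.prod_sum (fun (t : Fin k) (y' : Option (X t)) => anchorProb α (x t) y')]
      exact Finset.prod_eq_one fun t _ => anchorProb_sum α (x t)
    simp_rw [← Finset.mul_sum, h, mul_one, G.μ_sum]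
  V x' a := if h : ∀ t, (x' t).isSome = true then G.V (fun t => (x' t).get (h t)) a else true

/-- The condition `n ≥ log (4 / ε) / (ε ^ 5 * λ ^ 2)` with `λ` the expansion of the connection graph
of `G`; in `ℝ≥0∞` the right side is `0` for `λ = ⊤` and `⊤` for `λ = 0`. -/
def LargeRep (G : Game k X A) (ε : ℝ) (n : ℕ) : Prop :=
  ENNReal.ofReal (Real.log (4 / ε)) / (ENNReal.ofReal (ε ^ 5) * G.lam ^ 2) ≤ (n : ℝ≥0∞)

end Game

/-! Write `ρ` for the weight of the connection graph. All three decay bounds follow from one theorem,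
`Game.val_rep_le`: if the connection graph satisfies a Poincaré inequality `L * Var h ≤ ∑ ρ(x, x')
(h x - h x') ^ 2` with `0 < L ≤ 1`, and `val G ≤ 1 - ε`, then the value of the `n`-fold repetition is
at most `exp (-ε ^ 5 * L * n / (640 * log |A|))`. The dependence on `L` is linear, which is what lets
the weak constant `L = ρ_min ^ 2` of a connected game suffice.

An edge of the connection graph is obtained as follows: choose a player and a question tuple,
reveal the questions of all other players, and draw the question of the chosen player twice
(`Game.rho_eq_mixture`). Fix a strategy for the repeated game and a set `C` of coordinates, and
condition on winning in `C`. Let the latent variable `s` reveal the questions in `C` and, in each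
coordinate outside `C`, the questions of all players but a random one. Given `s` and the
answers in `C`, the question strings of the players are independent, so a player who knows `s` and
a question for the coordinate `i` can draw the rest of the string privately
(`Game.exists_wsec_win_eq`). It remains to see that `s` is nearly independent of the questions in a
typical coordinate `i`. The divergence caused by the conditioning is at most
`log (1 / Pr[win C]) + |C| log |A|`, and by its superadditivity it bounds the sum over `i` of the
squared Hellinger distances of the conditional distribution of the hidden question from the prior
(`sum_sqrt_wsec_sub_sq_le`). These distances bound the energy, in the connection graph, of the square
root of the conditional density of `s` relative to the questions in the coordinate `i`. By the
Poincaré inequality this square root is nearly constant (`Game.sum_win_le_of_mixture`). So some coordinate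
outside `C` is won with conditional probability at most `1 - ε / 2`, and growing `C` greedily
gives exponential decay. Summing over the answers in `C` costs only the term `|C| log |A|`, by
concavity of the entropy function (`Game.sum_winOn_insert_le`).

The Poincaré inequalities: for free games it is the Efron–Stein inequality; for anchored games,
Efron–Stein for the anchors together with the all-anchor tuple, which is common to all original
questions (`Game.anchored_poincare`); for connected games, Cauchy–Schwarz along paths of length at most
`1 / ρ_min` (`Game.IsConnected.sq_sub_le`).
-/

open Finset Function

/-! ### Resampling one coordinate -/

/-- The map `(x, y) ↦ (update x t y, x t)`, which exchanges the coordinate `t` of `x` with `y`, is an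
involution. -/
theorem sum_update_swap {ι : Type*} [Fintype ι] [DecidableEq ι] {X : ι → Type*} [∀ t, Fintype (X t)]
    (t : ι) (F : (∀ t, X t) → X t → ℝ) :
    ∑ x, ∑ y, F x y = ∑ x, ∑ y, F (update x t y) (x t) := by
  rw [← Fintype.sum_prod_type', ← Fintype.sum_prod_type']
  refine Finset.sum_nbij' (fun p => (update p.1 t p.2, p.1 t)) (fun p => (update p.1 t p.2, p.1 t))
    ?_ ?_ ?_ ?_ ?_ <;> simp

theorem prod_update_mul {ι : Type*} [Fintype ι] [DecidableEq ι] {X : ι → Type*}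
    (ν : ∀ t, X t → ℝ) (t : ι) (x : ∀ t, X t) (y : X t) :
    (∏ j, ν j (update x t y j)) * ν t (x t) = (∏ j, ν j (x j)) * ν t y := by
  rw [← Finset.mul_prod_erase univ _ (mem_univ t), ← Finset.mul_prod_erase univ _ (mem_univ t)]
  have : ∏ j ∈ univ.erase t, ν j (update x t y j) = ∏ j ∈ univ.erase t, ν j (x j) :=
    Finset.prod_congr rfl fun j hj => by rw [update_of_ne (Finset.ne_of_mem_erase hj)]
  rw [this, update_self]
  ring

theorem sum_prod_resample {ι : Type*} [Fintype ι] [DecidableEq ι] {X : ι → Type*}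
    [∀ t, Fintype (X t)] (ν : ∀ t, X t → ℝ) (t : ι) (hν : ∑ y, ν t y = 1) (g : (∀ t, X t) → ℝ) :
    ∑ x, (∏ j, ν j (x j)) * ∑ y, ν t y * g (update x t y) = ∑ x, (∏ j, ν j (x j)) * g x := by
  have h := sum_update_swap t fun x y => (∏ j, ν j (x j)) * (ν t y * g (update x t y))
  simp only [Finset.mul_sum, h, update_idem, update_eq_self]
  refine Finset.sum_congr rfl fun x _ => ?_
  simp_rw [← mul_assoc, prod_update_mul]
  rw [← Finset.sum_mul, ← Finset.mul_sum, hν, mul_one]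

theorem prod_update_apply {ι : Type*} [Fintype ι] [DecidableEq ι] {W : Type*}
    (q : ι → W → ℝ) (i : ι) (r : W → ℝ) (x : ι → W) :
    ∏ j, update q i r j (x j) = r (x i) * ∏ j ∈ univ.erase i, q j (x j) := by
  rw [← Finset.mul_prod_erase univ _ (mem_univ i), update_self]
  congr 1
  exact Finset.prod_congr rfl fun j hj => by rw [update_of_ne (Finset.ne_of_mem_erase hj)]

/-! ### Weighted sums over tuples and their sections -/

section wsum

variable {ι : Type*} [Fintype ι] [DecidableEq ι] {W : Type*} [Fintype W]

/-- The integral of `e` against the product of the weights `q j`. -/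
noncomputable def wsum (q : ι → W → ℝ) (e : (ι → W) → ℝ) : ℝ := ∑ x : ι → W, (∏ j, q j (x j)) * e x

theorem wsum_nonneg {q : ι → W → ℝ} {e : (ι → W) → ℝ} (hq : ∀ j y, 0 ≤ q j y) (he : ∀ x, 0 ≤ e x) :
    0 ≤ wsum q e :=
  Finset.sum_nonneg fun x _ => mul_nonneg (Finset.prod_nonneg fun j _ => hq j _) (he x)

open scoped Classical in
/-- The section of `wsum q e` in which the coordinate `i` is fixed to be `y`. -/
noncomputable def wsec (q : ι → W → ℝ) (e : (ι → W) → ℝ) (i : ι) (y : W) : ℝ :=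
  wsum (update q i (Pi.single y 1)) e

open scoped Classical in
theorem wsec_eq (q : ι → W → ℝ) (e : (ι → W) → ℝ) (i : ι) (y : W) :
    wsec q e i y = ∑ x : ι → W, (if x i = y then 1 else 0) * (∏ j ∈ univ.erase i, q j (x j)) * e x := by
  simp only [wsec, wsum, prod_update_apply, Pi.single_apply]

theorem wsec_update (q : ι → W → ℝ) (e : (ι → W) → ℝ) (i : ι) (r : W → ℝ) (y : W) :
    wsec (update q i r) e i y = wsec q e i y := by
  simp [wsec]

/-- Integration of a function of the coordinate `i` against the tilted product measure. -/
theorem sum_mul_wsec (q : ι → W → ℝ) (e : (ι → W) → ℝ) (i : ι) (c : W → ℝ) :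
    ∑ y, q i y * c y * wsec q e i y = ∑ x : ι → W, (∏ j, q j (x j)) * e x * c (x i) := by
  classical
  simp only [wsec_eq, Finset.mul_sum]
  rw [Finset.sum_comm]
  refine Finset.sum_congr rfl fun x _ => ?_
  rw [Finset.sum_eq_single (x i) (fun y _ hy => by simp [hy.symm]) (by simp),
    ← Finset.mul_prod_erase univ _ (mem_univ i)]
  simp only [if_true]
  ring

theorem wsum_eq_sum_wsec (q : ι → W → ℝ) (e : (ι → W) → ℝ) (i : ι) :
    wsum q e = ∑ y, q i y * wsec q e i y := by
  simpa [wsum] using (sum_mul_wsec q e i fun _ => 1).symm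

theorem wsec_nonneg {q : ι → W → ℝ} {e : (ι → W) → ℝ} (hq : ∀ j y, 0 ≤ q j y) (he : ∀ x, 0 ≤ e x)
    (i : ι) (y : W) : 0 ≤ wsec q e i y := by
  classical
  rw [wsec_eq]
  exact Finset.sum_nonneg fun x _ => mul_nonneg (mul_nonneg (by split_ifs <;> norm_num)
    (Finset.prod_nonneg fun j _ => hq j _)) (he x)

/-- Superadditivity of the divergence with respect to a product measure, in Hellinger form: if a
product measure is conditioned on an event of probability `M`, the squared Hellinger distances
between the old and the new marginals add up to at most `log (1 / M)`. -/
theorem sum_sqrt_wsec_sub_sq_le {q : ι → W → ℝ} {e : (ι → W) → ℝ} (hq : ∀ j y, 0 ≤ q j y)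
    (hq1 : ∀ j, ∑ y, q j y = 1) (he : ∀ x, 0 ≤ e x) (he1 : ∀ x, e x ≤ 1) :
    ∑ i, ∑ y, q i y * (√(wsec q e i y) - √(wsum q e)) ^ 2 ≤ Real.negMulLog (wsum q e) := by
  classical
  set M := wsum q e with hM
  have hM0 : 0 ≤ M := wsum_nonneg hq he
  have hs0 : ∀ i y, 0 ≤ wsec q e i y := wsec_nonneg hq he
  rcases hM0.eq_or_lt with h0 | hpos
  · rw [← h0]
    simp only [Real.sqrt_zero, sub_zero, Real.negMulLog_zero]
    refine le_of_eq (Finset.sum_eq_zero fun i _ => ?_)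
    rw [h0, hM, wsum_eq_sum_wsec q e i]
    exact Finset.sum_congr rfl fun y _ => by rw [Real.sq_sqrt (hs0 i y)]
  set w : (ι → W) → ℝ := fun x => (∏ j, q j (x j)) * e x with hw
  have hw0 : ∀ x, 0 ≤ w x := fun x => mul_nonneg (Finset.prod_nonneg fun j _ => hq j _) (he x)
  have hwM : ∑ x, w x = M := rfl
  -- the pointwise inequality `log u ≤ u - 1`, used for the density and for its marginals
  have key : ∀ x, w x * (Real.log M + ∑ i, 2 * (1 - √M / √(wsec q e i (x i)))) ≤
      M * ((∏ j, q j (x j) * (wsec q e j (x j) / M))) - w x := by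
    intro x
    rcases (hw0 x).eq_or_lt with hx | hx
    · rw [← hx]
      simp only [zero_mul, sub_zero]
      exact mul_nonneg hM0 (Finset.prod_nonneg fun j _ =>
        mul_nonneg (hq j _) (div_nonneg (hs0 _ _) hM0))
    have hsp : ∀ i, 0 < wsec q e i (x i) := by
      intro i
      rw [wsec_eq]
      refine lt_of_lt_of_le ?_ (Finset.single_le_sum (f := fun x' : ι → W =>
        (if x' i = x i then 1 else 0) * (∏ j ∈ univ.erase i, q j (x' j)) * e x')
        (fun x' _ => mul_nonneg (mul_nonneg (by split_ifs <;> norm_num)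
          (Finset.prod_nonneg fun j _ => hq j _)) (he x')) (mem_univ x))
      have h1 : (∏ j, q j (x j)) ≠ 0 := fun h => by simp [hw, h] at hx
      have h2 : e x ≠ 0 := fun h => by simp [hw, h] at hx
      have h3 : ∏ j ∈ univ.erase i, q j (x j) ≠ 0 := by
        rw [Finset.prod_ne_zero_iff] at h1 ⊢
        exact fun j _ => h1 j (mem_univ j)
      simp only [if_true, one_mul]
      exact mul_pos (lt_of_le_of_ne (Finset.prod_nonneg fun j _ => hq j _) h3.symm)
        (lt_of_le_of_ne (he x) h2.symm)
    have hr : ∀ i, 0 < wsec q e i (x i) / M := fun i => div_pos (hsp i) hpos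
    have hlog : ∀ i, 2 * (1 - √M / √(wsec q e i (x i))) ≤ Real.log (wsec q e i (x i) / M) := by
      intro i
      have hu : 0 < √M / √(wsec q e i (x i)) :=
        div_pos (Real.sqrt_pos.2 hpos) (Real.sqrt_pos.2 (hsp i))
      have h1 := Real.log_le_sub_one_of_pos hu
      rw [← Real.sqrt_div hM0, Real.log_sqrt (div_pos hpos (hsp i)).le,
        ← inv_div (wsec q e i (x i)) M, Real.log_inv] at h1
      rw [← Real.sqrt_div hM0, ← inv_div (wsec q e i (x i)) M]
      linarith
    have h2 : Real.log M + ∑ i, 2 * (1 - √M / √(wsec q e i (x i))) ≤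
        M * ∏ j, (wsec q e j (x j) / M) - 1 := by
      have h3 := Real.log_le_sub_one_of_pos (mul_pos hpos (Finset.prod_pos fun j (_ : j ∈ univ) => hr j))
      rw [Real.log_mul hpos.ne' (Finset.prod_pos fun j _ => hr j).ne',
        Real.log_prod fun j _ => (hr j).ne'] at h3
      linarith [Finset.sum_le_sum fun i (_ : i ∈ univ) => hlog i]
    refine (mul_le_mul_of_nonneg_left h2 hx.le).trans ?_
    have h4 : w x * (M * ∏ j, (wsec q e j (x j) / M)) ≤
        M * ∏ j, q j (x j) * (wsec q e j (x j) / M) := by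
      rw [Finset.prod_mul_distrib, hw]
      have h5 : 0 ≤ (∏ j, q j (x j)) * (M * ∏ j, (wsec q e j (x j) / M)) :=
        mul_nonneg (Finset.prod_nonneg fun j _ => hq j _)
          (mul_nonneg hM0 (Finset.prod_nonneg fun j _ => (hr j).le))
      nlinarith [mul_le_mul_of_nonneg_left (he1 x) h5]
    linarith
  have hsum := Finset.sum_le_sum fun x (_ : x ∈ univ) => key x
  have hR : ∑ x : ι → W, (M * (∏ j, q j (x j) * (wsec q e j (x j) / M)) - w x) = 0 := by
    rw [Finset.sum_sub_distrib, ← Finset.mul_sum,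
      ← Fintype.prod_sum fun j y => q j y * (wsec q e j y / M), hwM]
    have : ∀ j, ∑ y, q j y * (wsec q e j y / M) = 1 := by
      intro j
      simp_rw [← mul_div_assoc]
      rw [← Finset.sum_div, ← wsum_eq_sum_wsec, ← hM, div_self hpos.ne']
    simp [this]
  have hL : ∑ x, w x * (Real.log M + ∑ i, 2 * (1 - √M / √(wsec q e i (x i)))) =
      M * Real.log M + ∑ i, ∑ y, q i y * (√(wsec q e i y) - √M) ^ 2 := by
    simp_rw [mul_add, Finset.sum_add_distrib, ← Finset.sum_mul, hwM, Finset.mul_sum]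
    rw [Finset.sum_comm]
    congr 1
    refine Finset.sum_congr rfl fun i _ => ?_
    have h1 := sum_mul_wsec q e i fun y => 2 * (1 - √M / √(wsec q e i y))
    rw [← h1]
    have h2 : ∀ y, q i y * (√(wsec q e i y) - √M) ^ 2 =
        q i y * (2 * (1 - √M / √(wsec q e i y))) * wsec q e i y +
          (q i y * M - q i y * wsec q e i y) := by
      intro y
      rcases (hs0 i y).eq_or_lt with h | h
      · rw [← h]
        simp [Real.sq_sqrt hM0]
      · have h3 : √(wsec q e i y) ≠ 0 := (Real.sqrt_pos.2 h).ne'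
        have h4 : √M / √(wsec q e i y) * wsec q e i y = √M * √(wsec q e i y) := by
          rw [div_mul_eq_mul_div, div_eq_iff h3, mul_assoc, Real.mul_self_sqrt h.le]
        have h5 := Real.sq_sqrt h.le
        have h6 := Real.sq_sqrt hM0
        linear_combination q i y * h5 + q i y * h6 + 2 * q i y * h4
    simp_rw [h2, Finset.sum_add_distrib, Finset.sum_sub_distrib, ← Finset.sum_mul, hq1 i,
      ← wsum_eq_sum_wsec, ← hM]
    ring
  rw [hL, hR] at hsum
  rw [Real.negMulLog]
  linarith

end wsum

/-- Jensen's inequality for the entropy function `-p log p`. -/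
theorem sum_mul_negMulLog_le {S : Type*} [Fintype S] {w p : S → ℝ} (hw : ∀ s, 0 ≤ w s)
    (hw1 : ∑ s, w s = 1) (hp : ∀ s, 0 ≤ p s) :
    ∑ s, w s * Real.negMulLog (p s) ≤ Real.negMulLog (∑ s, w s * p s) :=
  Real.concaveOn_negMulLog.le_map_sum (fun s _ => hw s) hw1 fun s _ => hp s

/-- A sum over tuples of profiles factors over the players. -/
theorem sum_prod_swap {ι : Type*} [Fintype ι] [DecidableEq ι] {κ : Type*} [Fintype κ] [DecidableEq κ]
    {X : κ → Type*} [∀ t, Fintype (X t)] (φ : ∀ t, (ι → X t) → ℝ) :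
    ∑ x : ι → ∀ t, X t, ∏ t, φ t (fun j => x j t) = ∏ t, ∑ v, φ t v := by
  rw [Fintype.prod_sum]
  exact Fintype.sum_equiv (Equiv.piComm fun (_ : ι) (t : κ) => X t) _ _ fun x => rfl

/-! ### Randomized strategies -/

namespace Game

variable {k : ℕ} {X : Fin k → Type u} {A : Fin k → Type v} [∀ t, Fintype (X t)]

theorem winProb_nonneg (G : Game k X A) (f : ∀ t, X t → A t) : 0 ≤ G.winProb f :=
  Finset.sum_nonneg fun x _ => mul_nonneg (G.μ_nonneg x) (by split_ifs <;> norm_num)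

theorem winProb_le_one (G : Game k X A) (f : ∀ t, X t → A t) : G.winProb f ≤ 1 := by
  rw [← G.μ_sum]
  refine Finset.sum_le_sum fun x _ => ?_
  have := G.μ_nonneg x
  split_ifs <;> simp [this]

theorem winProb_le_val (G : Game k X A) (f : ∀ t, X t → A t) : G.winProb f ≤ G.val :=
  le_ciSup (f := G.winProb) ⟨1, by rintro _ ⟨f, rfl⟩; exact G.winProb_le_one f⟩ f

theorem val_nonneg (G : Game k X A) : 0 ≤ G.val :=
  Real.iSup_nonneg fun f => G.winProb_nonneg f

variable [∀ t, Fintype (A t)]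

/-- The probability that the answers drawn from the private distributions `π t` are accepted on the
question tuple `x`. -/
noncomputable def randWin (G : Game k X A) (π : ∀ t, X t → A t → ℝ) (x : ∀ t, X t) : ℝ :=
  ∑ a : ∀ t, A t, (if G.V x a = true then 1 else 0) * ∏ t, π t (x t) (a t)

/-- Private randomness does not help: a randomized strategy is a mixture of deterministic ones, in
which all answers of all players are drawn in advance. -/
theorem sum_randWin_le_val (G : Game k X A) (π : ∀ t, X t → A t → ℝ)
    (h0 : ∀ t y a, 0 ≤ π t y a) (h1 : ∀ t y, ∑ a, π t y a = 1) :
    ∑ x, G.μ x * G.randWin π x ≤ G.val := by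
  classical
  set P : (∀ t, X t → A t) → ℝ := fun f => ∏ t, ∏ y, π t y (f t y) with hP
  have hP0 : ∀ f, 0 ≤ P f := fun f => Finset.prod_nonneg fun t _ => Finset.prod_nonneg fun y _ => h0 _ _ _
  have hP1 : ∑ f, P f = 1 := by
    rw [hP, ← Fintype.prod_sum fun t (g : X t → A t) => ∏ y, π t y (g y)]
    refine Finset.prod_eq_one fun t _ => ?_
    rw [← Fintype.prod_sum fun y a => π t y a]
    exact Finset.prod_eq_one fun y _ => h1 t y
  have hx : ∀ x, G.randWin π x = ∑ f, P f * (if G.V x (fun t => f t (x t)) = true then 1 else 0) := by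
    intro x
    have h2 : ∀ a : ∀ t, A t, ∏ t, π t (x t) (a t) =
        ∑ f, P f * (if (fun t => f t (x t)) = a then 1 else 0) := by
      intro a
      have h3 : ∀ f : ∀ t, X t → A t, P f * (if (fun t => f t (x t)) = a then 1 else 0) =
          ∏ t, ∏ y, (π t y (f t y) * if y = x t then (if f t y = a t then 1 else 0) else 1) := by
        intro f
        simp_rw [Finset.prod_mul_distrib, Finset.prod_ite_eq' univ, mem_univ, if_true]
        rw [Finset.prod_ite_zero, Finset.prod_const_one]
        simp [hP, funext_iff]
      simp_rw [h3]
      rw [← Fintype.prod_sum fun t (g : X t → A t) =>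
        ∏ y, (π t y (g y) * if y = x t then (if g y = a t then 1 else 0) else 1)]
      refine Finset.prod_congr rfl fun t _ => ?_
      rw [← Fintype.prod_sum fun y b => π t y b * if y = x t then (if b = a t then 1 else 0) else 1]
      rw [Finset.prod_eq_single (x t)]
      · simp
      · intro y _ hy
        simp [hy, h1]
      · simp
    simp only [randWin, h2, Finset.mul_sum]
    rw [Finset.sum_comm]
    refine Finset.sum_congr rfl fun f _ => ?_
    rw [Finset.sum_eq_single (fun t => f t (x t)) (fun a _ ha => by simp [ha.symm]) (by simp)]
    simp [mul_comm]
  simp_rw [hx, Finset.mul_sum]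
  rw [Finset.sum_comm]
  calc ∑ f, ∑ x, G.μ x * (P f * (if G.V x (fun t => f t (x t)) = true then 1 else 0))
      = ∑ f, P f * G.winProb f := by
        refine Finset.sum_congr rfl fun f _ => ?_
        rw [winProb, Finset.mul_sum]
        exact Finset.sum_congr rfl fun x _ => by ring
    _ ≤ ∑ f, P f * G.val :=
        Finset.sum_le_sum fun f _ => mul_le_mul_of_nonneg_left (G.winProb_le_val f) (hP0 f)
    _ = G.val := by rw [← Finset.sum_mul, hP1, one_mul]

theorem randWin_nonneg (G : Game k X A) {π : ∀ t, X t → A t → ℝ} (h0 : ∀ t y a, 0 ≤ π t y a)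
    (x : ∀ t, X t) : 0 ≤ G.randWin π x :=
  Finset.sum_nonneg fun a _ => mul_nonneg (by split_ifs <;> norm_num)
    (Finset.prod_nonneg fun t _ => h0 _ _ _)

theorem randWin_le_one (G : Game k X A) {π : ∀ t, X t → A t → ℝ} (h0 : ∀ t y a, 0 ≤ π t y a)
    (h1 : ∀ t y, ∑ a, π t y a = 1) (x : ∀ t, X t) : G.randWin π x ≤ 1 := by
  calc G.randWin π x ≤ ∑ a : ∀ t, A t, ∏ t, π t (x t) (a t) := by
        refine Finset.sum_le_sum fun a _ => ?_
        have : 0 ≤ ∏ t, π t (x t) (a t) := Finset.prod_nonneg fun t _ => h0 _ _ _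
        split_ifs <;> simp [this]
    _ = 1 := by
        rw [← Fintype.prod_sum fun t a => π t (x t) a]
        exact Finset.prod_eq_one fun t _ => h1 t _

end Game

/-- The coordinate `i` may be drawn afresh wherever the integrand shows it only in the first argument
of `Ψ`. -/
theorem sum_prod_resample_of_indep {ι S : Type*} [Fintype ι] [DecidableEq ι] [Fintype S]
    {ν : S → ℝ} (hν1 : ∑ s, ν s = 1) (i : ι) (Ψ : S → (ι → S) → ℝ)
    (hΨ : ∀ s' s a, Ψ s' (update s i a) = Ψ s' s) :
    ∑ s : ι → S, (∏ j, ν (s j)) * Ψ (s i) s =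
      ∑ s : ι → S, (∏ j, ν (s j)) * ∑ s', ν s' * Ψ s' s := by
  rw [← sum_prod_resample (fun _ : ι => ν) i hν1 fun s => Ψ (s i) s]
  simp [hΨ]

theorem sum_mixture_mul {S W : Type*} [Fintype S] [Fintype W] (ν : S → ℝ) (a : S → W → ℝ)
    (D : W → W → ℝ) :
    ∑ x, ∑ x', (∑ s, ν s * (a s x * a s x')) * D x x' =
      ∑ s, ν s * ∑ x, ∑ x', a s x * a s x' * D x x' := by
  simp only [Finset.mul_sum]
  rw [Finset.sum_comm (s := univ (α := S))]
  refine Finset.sum_congr rfl fun x _ => ?_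
  rw [Finset.sum_comm (s := univ (α := S))]
  refine Finset.sum_congr rfl fun x' _ => ?_
  rw [Finset.sum_mul]
  exact Finset.sum_congr rfl fun s _ => by ring

namespace Game

/-! ### The average winning probability conditioned on a product event -/

variable {k : ℕ} {X : Fin k → Type u} {A : Fin k → Type v} [∀ t, Fintype (X t)]
  [∀ t, Fintype (A t)]

open scoped Classical in
/-- Rounding to the base game: if the question strings of the players are drawn independently, with
the weights `r j t` in the coordinates `j ≠ i` and tilted by the functions `e t`, then the players
can complete a question tuple `y`, put in the coordinate `i`, with private randomness, and use the
`i`-th answer. -/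
theorem exists_wsec_win_eq [∀ t, Nonempty (A t)] (G : Game k X A) {ι : Type*} [Fintype ι]
    [DecidableEq ι] {r : ι → ∀ t, X t → ℝ} (hr : ∀ j t y, 0 ≤ r j t y)
    {e : ∀ t, (ι → X t) → ℝ} (he : ∀ t v, 0 ≤ e t v) (i : ι) (f : ∀ t, (ι → X t) → A t) :
    ∃ ω : (∀ t, X t) → ℝ, (∀ y, 0 ≤ ω y) ∧ (∀ y, ω y ≤ 1) ∧ ∑ y, G.μ y * ω y ≤ G.val ∧
      ∀ y, wsec (fun j (x : ∀ t, X t) => ∏ t, r j t (x t))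
        (fun x => (∏ t, e t (fun j => x j t)) *
          (if G.V (x i) (fun t => f t (fun j => x j t)) = true then 1 else 0)) i y =
        ω y * wsec (fun j (x : ∀ t, X t) => ∏ t, r j t (x t))
          (fun x => ∏ t, e t (fun j => x j t)) i y := by
  set B : ∀ t, X t → (ι → X t) → ℝ := fun t y v =>
    (if v i = y then 1 else 0) * (∏ j ∈ univ.erase i, r j t (v j)) * e t v with hB
  have hB0 : ∀ t y v, 0 ≤ B t y v := fun t y v => mul_nonneg (mul_nonneg
    (by split_ifs <;> norm_num) (Finset.prod_nonneg fun j _ => hr _ _ _)) (he _ _)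
  set M : ∀ t, X t → ℝ := fun t y => ∑ v, B t y v with hM
  have hM0 : ∀ t y, 0 ≤ M t y := fun t y => Finset.sum_nonneg fun v _ => hB0 t y v
  set N : ∀ t, X t → A t → ℝ := fun t y a => ∑ v, B t y v * (if f t v = a then 1 else 0) with hN
  have hN0 : ∀ t y a, 0 ≤ N t y a := fun t y a => Finset.sum_nonneg fun v _ =>
    mul_nonneg (hB0 t y v) (by split_ifs <;> norm_num)
  have hNM : ∀ t y, ∑ a, N t y a = M t y := by
    intro t y
    simp only [hN, hM]
    rw [Finset.sum_comm]
    exact Finset.sum_congr rfl fun v _ => by simp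
  have hBx : ∀ (y : ∀ t, X t) (x : ι → ∀ t, X t), ∏ t, B t (y t) (fun j => x j t) =
      (if x i = y then 1 else 0) * (∏ j ∈ univ.erase i, ∏ t, r j t (x j t)) *
        ∏ t, e t (fun j => x j t) := by
    intro y x
    simp only [hB, Finset.prod_mul_distrib]
    rw [Finset.prod_comm (s := univ) (t := univ.erase i), Finset.prod_ite_zero,
      Finset.prod_const_one]
    simp [funext_iff]
  have hMsec : ∀ y, wsec (fun j (x : ∀ t, X t) => ∏ t, r j t (x t))
      (fun x => ∏ t, e t (fun j => x j t)) i y = ∏ t, M t (y t) := by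
    intro y
    rw [wsec_eq, hM, ← sum_prod_swap fun t v => B t (y t) v]
    refine Finset.sum_congr rfl fun x _ => ?_
    rw [hBx]
    congr
  have hNsec : ∀ y, wsec (fun j (x : ∀ t, X t) => ∏ t, r j t (x t))
      (fun x => (∏ t, e t (fun j => x j t)) *
        (if G.V (x i) (fun t => f t (fun j => x j t)) = true then 1 else 0)) i y = G.randWin N y := by
    intro y
    have h1 : ∀ a : ∀ t, A t, ∏ t, N t (y t) (a t) = ∑ x : ι → ∀ t, X t,
        (∏ t, B t (y t) (fun j => x j t)) *
          (if (fun t => f t (fun j => x j t)) = a then 1 else 0) := by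
      intro a
      rw [hN, ← sum_prod_swap fun t v => B t (y t) v * (if f t v = a t then 1 else 0)]
      refine Finset.sum_congr rfl fun x _ => ?_
      rw [Finset.prod_mul_distrib, Finset.prod_ite_zero, Finset.prod_const_one]
      simp [funext_iff]
    simp only [randWin, h1, Finset.mul_sum]
    rw [Finset.sum_comm, wsec_eq]
    refine Finset.sum_congr rfl fun x _ => ?_
    rw [Finset.sum_eq_single (fun t => f t (fun j => x j t)) (fun a _ ha => by simp [ha.symm])
      (by simp), hBx]
    by_cases hxy : x i = y
    · simp [hxy]
    · simp [hxy]
  set π : ∀ t, X t → A t → ℝ := fun t y a =>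
    if M t y = 0 then (if a = Classical.arbitrary (A t) then 1 else 0) else N t y a / M t y with hπ
  have hπ0 : ∀ t y a, 0 ≤ π t y a := by
    intro t y a
    simp only [hπ]
    split_ifs
    exacts [zero_le_one, le_rfl, div_nonneg (hN0 _ _ _) (hM0 _ _)]
  have hπ1 : ∀ t y, ∑ a, π t y a = 1 := by
    intro t y
    by_cases h : M t y = 0
    · simp [hπ, h]
    · simp only [hπ, h, if_false]
      rw [← Finset.sum_div, hNM, div_self h]
  have hπN : ∀ t y a, N t y a = π t y a * M t y := by
    intro t y a
    by_cases h : M t y = 0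
    · have h2 : N t y a ≤ ∑ a, N t y a :=
        Finset.single_le_sum (f := fun a => N t y a) (fun a _ => hN0 t y a) (mem_univ a)
      rw [hNM, h] at h2
      rw [h, mul_zero]
      exact le_antisymm h2 (hN0 _ _ _)
    · simp only [hπ, h, if_false]
      rw [div_mul_cancel₀ _ h]
  refine ⟨G.randWin π, G.randWin_nonneg hπ0, G.randWin_le_one hπ0 hπ1,
    G.sum_randWin_le_val π hπ0 hπ1, fun y => ?_⟩
  rw [hMsec, hNsec]
  simp only [randWin, hπN, Finset.prod_mul_distrib, Finset.sum_mul]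
  exact Finset.sum_congr rfl fun a _ => by ring

/-- The Poincaré inequality, for scalar functions and with constant `L`, for the weighted
graph `ρ` on the question tuples. -/
def Poincare (G : Game k X A) (ρ : (∀ t, X t) → (∀ t, X t) → ℝ) (L : ℝ) : Prop :=
  ∀ h : (∀ t, X t) → ℝ, L * ∑ x, G.μ x * (h x - ∑ y, G.μ y * h y) ^ 2 ≤
    ∑ x, ∑ x', ρ x x' * (h x - h x') ^ 2

/-- The main estimate. The question tuples of all coordinates `j` are mixtures, over public latent
variables `s j` with distribution `ν`, of product kernels `q j (s j)`, and the event conditioned on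
is, given the latent variables, a product over the players (with indicator functions `e s t`). For
the coordinates in `I`, let `m s i y` be the probability of the event when the coordinate `i` holds
`y` and the others are drawn given `s`. As `i` varies, the functions `√(m s i ·)` have small energy
in the graph of the mixture by `sum_sqrt_wsec_sub_sq_le`, so by the Poincaré inequality they are
nearly constant; that is, conditioned on the event, `s` and the question tuple in the coordinate `i`
are nearly independent, and the players of the base game can draw `s` from shared randomness. -/
theorem sum_win_le_of_mixture [∀ t, Nonempty (A t)] (G : Game k X A) {ι S : Type*} [Fintype ι]
    [DecidableEq ι] [Fintype S] {ν : S → ℝ} (hν : ∀ s, 0 ≤ ν s) (hν1 : ∑ s, ν s = 1)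
    {q : ι → S → ∀ t, X t → ℝ} (hq : ∀ j s t y, 0 ≤ q j s t y) (hq1 : ∀ j s t, ∑ y, q j s t y = 1)
    (hqμ : ∀ j x, ∑ s, ν s * ∏ t, q j s t (x t) = G.μ x) {I : Finset ι} {L : ℝ} (hL : 0 < L)
    (hP : ∀ i ∈ I, G.Poincare (fun x x' =>
      ∑ s, ν s * ((∏ t, q i s t (x t)) * ∏ t, q i s t (x' t))) L)
    {e : (ι → S) → ∀ t, (ι → X t) → ℝ} (he : ∀ s t v, 0 ≤ e s t v) (he1 : ∀ s t v, e s t v ≤ 1)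
    (heI : ∀ i ∈ I, ∀ s a, e (update s i a) = e s) (f : ∀ t, (ι → X t) → ι → A t)
    {θ : ℝ} (hθ : 0 < θ) {p : ℝ}
    (hp : ∑ s : ι → S, (∏ j, ν (s j)) * wsum (fun j (x : ∀ t, X t) => ∏ t, q j (s j) t (x t))
      (fun x => ∏ t, e s t (fun j => x j t)) = p) :
    ∑ i ∈ I, ∑ s : ι → S, (∏ j, ν (s j)) *
      wsum (fun j (x : ∀ t, X t) => ∏ t, q j (s j) t (x t))
        (fun x => (∏ t, e s t (fun j => x j t)) *
          (if G.V (x i) (fun t => f t (fun j => x j t) i) = true then 1 else 0)) ≤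
      (1 + θ) * I.card * G.val * p + (1 + 1 / θ) * (2 / L) * Real.negMulLog p := by
  set Q : (ι → S) → ι → (∀ t, X t) → ℝ := fun s j x => ∏ t, q j (s j) t (x t) with hQ
  set E : (ι → S) → (ι → ∀ t, X t) → ℝ := fun s x => ∏ t, e s t (fun j => x j t) with hE
  set w : (ι → S) → ℝ := fun s => ∏ j, ν (s j) with hw
  have hQ0 : ∀ s j x, 0 ≤ Q s j x := fun s j x => Finset.prod_nonneg fun t _ => hq _ _ _ _
  have hκ1 : ∀ j s, ∑ x : ∀ t, X t, ∏ t, q j s t (x t) = 1 := by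
    intro j s
    rw [← Fintype.prod_sum fun t y => q j s t y]
    exact Finset.prod_eq_one fun t _ => hq1 _ _ _
  have hQ1 : ∀ s j, ∑ x, Q s j x = 1 := fun s j => hκ1 j (s j)
  have hE0 : ∀ s x, 0 ≤ E s x := fun s x => Finset.prod_nonneg fun t _ => he _ _ _
  have hE1 : ∀ s x, E s x ≤ 1 := fun s x => Finset.prod_le_one (fun t _ => he _ _ _) fun t _ => he1 _ _ _
  have hw0 : ∀ s, 0 ≤ w s := fun s => Finset.prod_nonneg fun j _ => hν _
  have hw1 : ∑ s, w s = 1 := by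
    rw [hw, ← Fintype.prod_sum fun (_ : ι) s => ν s]
    exact Finset.prod_eq_one fun j _ => hν1
  set m : (ι → S) → ι → (∀ t, X t) → ℝ := fun s i y => wsec (Q s) (E s) i y with hm
  have hm0 : ∀ s i y, 0 ≤ m s i y := fun s i y => wsec_nonneg (hQ0 s) (hE0 s) i y
  have hQu : ∀ s i a, Q (update s i a) = update (Q s) i fun x => ∏ t, q i a t (x t) := by
    intro s i a
    funext j
    by_cases hj : j = i
    · subst hj
      simp [hQ]
    · simp [hQ, hj]
  have hEu : ∀ i ∈ I, ∀ s a, E (update s i a) = E s := fun i hi s a => by simp [hE, heI i hi s a]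
  have hmu : ∀ i ∈ I, ∀ s a, m (update s i a) i = m s i := by
    intro i hi s a
    funext y
    simp only [hm]
    rw [hQu, hEu i hi, wsec_update]
  -- if `c s` does not depend on `s i`, averaging over `s i` replaces the kernel by `μ`
  have havg : ∀ i ∈ I, ∀ c : (ι → S) → (∀ t, X t) → ℝ, (∀ s a, c (update s i a) = c s) →
      ∑ s, w s * ∑ y, Q s i y * c s y = ∑ s, w s * ∑ y, G.μ y * c s y := by
    intro i hi c hc
    rw [hw, sum_prod_resample_of_indep hν1 i
      (fun s' s => ∑ y : ∀ t, X t, (∏ t, q i s' t (y t)) * c s y) (by simp [hc])]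
    refine Finset.sum_congr rfl fun s _ => ?_
    congr 1
    simp only [Finset.mul_sum]
    rw [Finset.sum_comm]
    refine Finset.sum_congr rfl fun y _ => ?_
    rw [← hqμ i y, Finset.sum_mul]
    exact Finset.sum_congr rfl fun s' _ => by ring
  have hpm : ∀ i ∈ I, ∑ s, w s * ∑ y, G.μ y * m s i y = p := by
    intro i hi
    rw [← hp, ← havg i hi (fun s => m s i) fun s a => hmu i hi s a]
    exact Finset.sum_congr rfl fun s _ => by rw [wsum_eq_sum_wsec _ _ i]
  set H : ι → ℝ := fun i => ∑ s, w s * ∑ y, Q s i y * (√(m s i y) - √(wsum (Q s) (E s))) ^ 2 with hH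
  have hH0 : ∀ i, 0 ≤ H i := fun i => Finset.sum_nonneg fun s _ => mul_nonneg (hw0 s)
    (Finset.sum_nonneg fun y _ => mul_nonneg (hQ0 _ _ _) (sq_nonneg _))
  have hHsum : ∑ i ∈ I, H i ≤ Real.negMulLog p := by
    calc ∑ i ∈ I, H i ≤ ∑ i, H i :=
          Finset.sum_le_sum_of_subset_of_nonneg (subset_univ I) fun i _ _ => hH0 i
      _ = ∑ s, w s * ∑ i, ∑ y, Q s i y * (√(m s i y) - √(wsum (Q s) (E s))) ^ 2 := by
          simp only [hH, Finset.mul_sum]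
          rw [Finset.sum_comm]
      _ ≤ ∑ s, w s * Real.negMulLog (wsum (Q s) (E s)) :=
          Finset.sum_le_sum fun s _ => mul_le_mul_of_nonneg_left
            (sum_sqrt_wsec_sub_sq_le (hQ0 s) (hQ1 s) (hE0 s) (hE1 s)) (hw0 s)
      _ ≤ Real.negMulLog p := by
          rw [← hp]
          exact sum_mul_negMulLog_le hw0 hw1 fun s => wsum_nonneg (hQ0 s) (hE0 s)
  set b : (ι → S) → ι → ℝ := fun s i => ∑ y, G.μ y * √(m s i y) with hb
  -- the Poincaré inequality bounds the variance by the energy, hence by the Hellinger distances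
  have hvar : ∀ i ∈ I, ∑ s, w s * ∑ y, G.μ y * (√(m s i y) - b s i) ^ 2 ≤ 2 / L * H i := by
    intro i hi
    have h1 : L * ∑ s, w s * ∑ y, G.μ y * (√(m s i y) - b s i) ^ 2 ≤
        ∑ s, w s * ∑ s', ν s' * ∑ x : ∀ t, X t, ∑ x' : ∀ t, X t,
          (∏ t, q i s' t (x t)) * (∏ t, q i s' t (x' t)) * (√(m s i x) - √(m s i x')) ^ 2 := by
      rw [Finset.mul_sum]
      refine Finset.sum_le_sum fun s _ => ?_
      have h2 := mul_le_mul_of_nonneg_left (hP i hi fun y => √(m s i y)) (hw0 s)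
      calc _ = w s * (L * ∑ y, G.μ y * (√(m s i y) - b s i) ^ 2) := by ring
        _ ≤ _ := h2
        _ = _ := by
          rw [sum_mixture_mul]
    rw [← sum_prod_resample_of_indep hν1 i (fun s' s => ∑ x : ∀ t, X t, ∑ x' : ∀ t, X t,
          (∏ t, q i s' t (x t)) * (∏ t, q i s' t (x' t)) * (√(m s i x) - √(m s i x')) ^ 2)
          (by simp [hmu i hi])] at h1
    have h3 : ∑ s, w s * ∑ x, ∑ x', Q s i x * Q s i x' * (√(m s i x) - √(m s i x')) ^ 2 ≤ 2 * H i := by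
      rw [hH, Finset.mul_sum]
      refine Finset.sum_le_sum fun s _ => ?_
      rw [mul_left_comm]
      refine mul_le_mul_of_nonneg_left ?_ (hw0 s)
      set z := √(wsum (Q s) (E s))
      set g : (∀ t, X t) → ℝ := fun x => √(m s i x) - z with hg
      have h4 : ∀ x x', Q s i x * Q s i x' * (√(m s i x) - √(m s i x')) ^ 2 =
          Q s i x * g x ^ 2 * Q s i x' + Q s i x * (Q s i x' * g x' ^ 2) -
            2 * (Q s i x * g x * (Q s i x' * g x')) := fun x x' => by simp only [hg]; ring
      simp_rw [h4, Finset.sum_sub_distrib, Finset.sum_add_distrib, ← Finset.mul_sum,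
        ← Finset.sum_mul, hQ1, one_mul, mul_one]
      nlinarith [mul_self_nonneg (∑ x, Q s i x * g x)]
    rw [div_mul_eq_mul_div, le_div_iff₀ hL, mul_comm]
    exact h1.trans h3
  have hone : ∀ i ∈ I, ∑ s, w s * wsum (Q s) (fun x => E s x *
      (if G.V (x i) (fun t => f t (fun j => x j t) i) = true then 1 else 0)) ≤
      (1 + θ) * G.val * p + (1 + 1 / θ) * (2 / L * H i) := by
    intro i hi
    choose ω hω0 hω1 hωv hω using fun s : ι → S => G.exists_wsec_win_eq (r := fun j => q j (s j))
      (fun j t y => hq j (s j) t y) (e := e s) (he s) i (fun t v => f t v i)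
    have h1 : ∑ s, w s * wsum (Q s) (fun x => E s x *
        (if G.V (x i) (fun t => f t (fun j => x j t) i) = true then 1 else 0)) =
        ∑ s, w s * ∑ y, G.μ y * (ω s y * m s i y) := by
      simp_rw [wsum_eq_sum_wsec _ _ i]
      rw [havg i hi (fun s y => wsec (Q s) (fun x => E s x *
        (if G.V (x i) (fun t => f t (fun j => x j t) i) = true then 1 else 0)) i y)]
      · exact Finset.sum_congr rfl fun s _ => by
          congr 1
          exact Finset.sum_congr rfl fun y _ => congrArg _ (hω s y)
      · intro s a
        funext y
        rw [hQu, hEu i hi, wsec_update]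
    have hbp : ∑ s, w s * b s i ^ 2 ≤ p := by
      rw [← hpm i hi]
      refine Finset.sum_le_sum fun s _ => mul_le_mul_of_nonneg_left ?_ (hw0 s)
      have := (convexOn_pow (𝕜 := ℝ) 2).map_sum_le (t := univ) (w := G.μ) (p := fun y => √(m s i y))
        (fun y _ => G.μ_nonneg y) G.μ_sum fun y _ => Real.sqrt_nonneg _
      simp only [smul_eq_mul, Real.sq_sqrt (hm0 s i _)] at this
      exact this
    -- a weighted form of `(a + b) ^ 2 ≤ 2 * (a ^ 2 + b ^ 2)`, with weight close to one on the mean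
    have hpt : ∀ s y, ω s y * m s i y ≤ (1 + θ) * (b s i ^ 2 * ω s y) +
        (1 + 1 / θ) * (√(m s i y) - b s i) ^ 2 := by
      intro s y
      have h2 := Real.sq_sqrt (hm0 s i y)
      have h3 : m s i y ≤ (1 + θ) * b s i ^ 2 + (1 + 1 / θ) * (√(m s i y) - b s i) ^ 2 := by
        have h4 : 0 ≤ (θ * b s i - (√(m s i y) - b s i)) ^ 2 / θ := div_nonneg (sq_nonneg _) hθ.le
        have h5 : (θ * b s i - (√(m s i y) - b s i)) ^ 2 / θ =
          (1 + θ) * b s i ^ 2 + (1 + 1 / θ) * (√(m s i y) - b s i) ^ 2 - √(m s i y) ^ 2 := by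
          field_simp
          ring
        linarith
      have h6 : 0 ≤ (1 + 1 / θ) * (√(m s i y) - b s i) ^ 2 := by positivity
      nlinarith [mul_le_mul_of_nonneg_left h3 (hω0 s y), mul_le_mul_of_nonneg_right (hω1 s y) h6]
    rw [h1]
    calc ∑ s, w s * ∑ y, G.μ y * (ω s y * m s i y)
        ≤ ∑ s, w s * ∑ y, G.μ y * ((1 + θ) * (b s i ^ 2 * ω s y) +
            (1 + 1 / θ) * (√(m s i y) - b s i) ^ 2) :=
          Finset.sum_le_sum fun s _ => mul_le_mul_of_nonneg_left (Finset.sum_le_sum fun y _ =>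
            mul_le_mul_of_nonneg_left (hpt s y) (G.μ_nonneg y)) (hw0 s)
      _ = (1 + θ) * ∑ s, w s * b s i ^ 2 * ∑ y, G.μ y * ω s y +
            (1 + 1 / θ) * ∑ s, w s * ∑ y, G.μ y * (√(m s i y) - b s i) ^ 2 := by
          simp only [Finset.mul_sum, ← Finset.sum_add_distrib]
          exact Finset.sum_congr rfl fun s _ => Finset.sum_congr rfl fun y _ => by ring
      _ ≤ (1 + θ) * (p * G.val) + (1 + 1 / θ) * (2 / L * H i) := by
          refine add_le_add (mul_le_mul_of_nonneg_left ?_ (by positivity))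
            (mul_le_mul_of_nonneg_left (hvar i hi) (by positivity))
          refine (Finset.sum_le_sum fun s _ => mul_le_mul_of_nonneg_left (hωv s)
            (mul_nonneg (hw0 s) (sq_nonneg _))).trans ?_
          rw [← Finset.sum_mul]
          exact mul_le_mul_of_nonneg_right hbp G.val_nonneg
      _ = _ := by ring
  calc _ ≤ ∑ i ∈ I, ((1 + θ) * G.val * p + (1 + 1 / θ) * (2 / L * H i)) :=
        Finset.sum_le_sum hone
    _ = (1 + θ) * I.card * G.val * p + (1 + 1 / θ) * (2 / L) * ∑ i ∈ I, H i := by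
        rw [Finset.sum_add_distrib, Finset.sum_const, nsmul_eq_mul, ← Finset.mul_sum,
          ← Finset.mul_sum]
        ring
    _ ≤ _ := by
        have : 0 ≤ (1 + 1 / θ) * (2 / L) := by positivity
        linarith [mul_le_mul_of_nonneg_left hHsum this]

end Game

/-! ### The connection graph as a mixture of product kernels -/

namespace Game

section reveal

variable {k : ℕ} {X : Fin k → Type u}

open scoped Classical in
/-- The kernel that reveals the question of player `t`. -/
noncomputable def revealKer (s : Fin k × ∀ t, X t) (t : Fin k) (y : X t) : ℝ :=
  if y = s.2 t then 1 else 0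

theorem revealKer_nonneg (s : Fin k × ∀ t, X t) (t : Fin k) (y : X t) : 0 ≤ revealKer s t y := by
  unfold revealKer
  split_ifs <;> norm_num

open scoped Classical in
theorem prod_revealKer (s : Fin k × ∀ t, X t) (x : ∀ t, X t) :
    ∏ t, revealKer s t (x t) = if x = s.2 then 1 else 0 := by
  simp only [revealKer]
  rw [Finset.prod_ite_zero, Finset.prod_const_one]
  simp [funext_iff]

end reveal

section graph

variable {k : ℕ} {X : Fin k → Type u} {A : Fin k → Type v} [∀ t, Fintype (X t)]

theorem margExcept_nonneg (G : Game k X A) (t : Fin k) (x : ∀ t, X t) : 0 ≤ G.margExcept t x :=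
  Finset.sum_nonneg fun _ _ => G.μ_nonneg _

theorem condProb_nonneg (G : Game k X A) (t : Fin k) (x : ∀ t, X t) (y : X t) :
    0 ≤ G.condProb t x y :=
  div_nonneg (G.μ_nonneg _) (G.margExcept_nonneg t x)

theorem margExcept_update (G : Game k X A) (t : Fin k) (x : ∀ t, X t) (y : X t) :
    G.margExcept t (update x t y) = G.margExcept t x := by
  simp [margExcept]

theorem condProb_update (G : Game k X A) (t : Fin k) (x : ∀ t, X t) (y : X t) :
    G.condProb t (update x t y) = G.condProb t x := by
  funext z
  simp [condProb, margExcept_update]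

theorem le_margExcept (G : Game k X A) (t : Fin k) (x : ∀ t, X t) (y : X t) :
    G.μ (update x t y) ≤ G.margExcept t x :=
  Finset.single_le_sum (f := fun y => G.μ (update x t y)) (fun _ _ => G.μ_nonneg _) (mem_univ y)

theorem margExcept_ne_zero (G : Game k X A) (t : Fin k) {x : ∀ t, X t} (hx : G.μ x ≠ 0) :
    G.margExcept t x ≠ 0 := by
  have h := G.le_margExcept t x (x t)
  rw [update_eq_self] at h
  exact (lt_of_lt_of_le (lt_of_le_of_ne (G.μ_nonneg x) hx.symm) h).ne'

theorem margExcept_mul_condProb (G : Game k X A) (t : Fin k) (x : ∀ t, X t) (y : X t) :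
    G.margExcept t x * G.condProb t x y = G.μ (update x t y) := by
  by_cases h : G.margExcept t x = 0
  · rw [h, zero_mul]
    exact le_antisymm (G.μ_nonneg _) (h ▸ G.le_margExcept t x y)
  · rw [condProb, mul_div_cancel₀ _ h]

theorem sum_condProb (G : Game k X A) (t : Fin k) {x : ∀ t, X t} (hx : G.margExcept t x ≠ 0) :
    ∑ y, G.condProb t x y = 1 := by
  simp only [condProb]
  rw [← Finset.sum_div]
  exact div_self hx

open scoped Classical in
theorem sum_ite_agree (t : Fin k) (x : ∀ t, X t) (g : (∀ t, X t) → ℝ) :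
    ∑ z, (if ∀ s, s ≠ t → x s = z s then g z else 0) = ∑ y, g (update x t y) := by
  rw [← Finset.sum_filter]
  refine Finset.sum_nbij' (fun z => z t) (fun y => update x t y) ?_ ?_ ?_ ?_ ?_
  · simp
  · intro y _
    simp only [mem_filter, mem_univ, true_and]
    intro s hs
    rw [update_of_ne hs]
  · intro z hz
    simp only [mem_filter, mem_univ, true_and] at hz
    funext s
    by_cases hs : s = t
    · subst hs
      simp
    · rw [update_of_ne hs, hz s hs]
  · simp
  · intro z hz
    simp only [mem_filter, mem_univ, true_and] at hz
    congr 1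
    funext s
    by_cases hs : s = t
    · subst hs
      simp
    · rw [update_of_ne hs, hz s hs]

open scoped Classical in
/-- The two cases in the definition of `rho` agree: `x'` arises from `x ∼ μ` by resampling the question
of a random player. -/
theorem rho_eq_sum (G : Game k X A) (x x' : ∀ t, X t) :
    G.rho x x' = ∑ t, if ∀ s, s ≠ t → x s = x' s then
      1 / (k : ℝ) * (G.μ x * G.condProb t x (x' t)) else 0 := by
  have h : ∀ t, G.margExcept t x * G.condProb t x (x t) = G.μ x := fun t => by
    rw [margExcept_mul_condProb, update_eq_self]
  by_cases hx : x = x'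
  · subst hx
    simp [rho, Finset.mul_sum]
  · simp [rho, hx, h]

theorem rho_nonneg (G : Game k X A) (x x' : ∀ t, X t) : 0 ≤ G.rho x x' := by
  classical
  rw [rho_eq_sum]
  refine Finset.sum_nonneg fun t _ => ?_
  have := G.μ_nonneg x
  have := G.condProb_nonneg t x (x' t)
  split_ifs <;> positivity

theorem sum_rho_mul (G : Game k X A) (D : (∀ t, X t) → (∀ t, X t) → ℝ) :
    ∑ x, ∑ x', G.rho x x' * D x x' =
      1 / (k : ℝ) * ∑ t, ∑ x, G.μ x * ∑ y, G.condProb t x y * D x (update x t y) := by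
  classical
  simp only [rho_eq_sum, Finset.sum_mul]
  have hR : 1 / (k : ℝ) * ∑ t, ∑ x, G.μ x * ∑ y, G.condProb t x y * D x (update x t y) =
      ∑ x, ∑ t, 1 / (k : ℝ) * (G.μ x * ∑ y, G.condProb t x y * D x (update x t y)) := by
    rw [Finset.sum_comm, Finset.mul_sum]
    exact Finset.sum_congr rfl fun x _ => Finset.mul_sum _ _ _
  rw [hR]
  refine Finset.sum_congr rfl fun x _ => ?_
  rw [Finset.sum_comm]
  refine Finset.sum_congr rfl fun t _ => ?_
  simp only [ite_mul, zero_mul]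
  rw [sum_ite_agree t x fun z => 1 / (k : ℝ) * (G.μ x * G.condProb t x (z t)) * D x z,
    Finset.mul_sum, Finset.mul_sum]
  exact Finset.sum_congr rfl fun y _ => by
    rw [update_self]
    ring

theorem weight_rho (G : Game k X A) (hk : 1 ≤ k) (x : ∀ t, X t) : WGraph.weight G.rho x = G.μ x := by
  classical
  have hk' : (k : ℝ) ≠ 0 := by positivity
  simp only [WGraph.weight, rho_eq_sum]
  rw [Finset.sum_comm]
  have : ∀ t, ∑ x' : ∀ t, X t, (if ∀ s, s ≠ t → x s = x' s then
      1 / (k : ℝ) * (G.μ x * G.condProb t x (x' t)) else 0) = 1 / (k : ℝ) * G.μ x := by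
    intro t
    rw [sum_ite_agree t x fun z => 1 / (k : ℝ) * (G.μ x * G.condProb t x (z t))]
    simp only [update_self, ← Finset.mul_sum]
    by_cases hx : G.μ x = 0
    · simp [hx]
    · rw [G.sum_condProb t (G.margExcept_ne_zero t hx), mul_one]
  rw [Finset.sum_congr rfl fun t _ => this t]
  simp
  field_simp

open scoped Classical in
/-- The kernel that reveals the question of player `t`, except if `t` is the player `s.1`, whose
question is drawn afresh given those of the others. (Tuples `s.2` for which the conditional
distribution is undefined have weight zero; there, the question is revealed.) -/
noncomputable def hideKer (G : Game k X A) (s : Fin k × ∀ t, X t) (t : Fin k) (y : X t) : ℝ :=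
  if t = s.1 then
    if G.margExcept t s.2 = 0 then revealKer s t y else G.condProb t s.2 y
  else revealKer s t y

/-- The distribution of a uniformly random player and an independent question tuple. -/
noncomputable def hideWeight (G : Game k X A) (s : Fin k × ∀ t, X t) : ℝ := G.μ s.2 / k

theorem sum_revealKer (s : Fin k × ∀ t, X t) (t : Fin k) : ∑ y, revealKer s t y = 1 := by
  classical
  simp only [revealKer]
  rw [Finset.sum_ite_eq' univ]
  simp

theorem hideKer_nonneg (G : Game k X A) (s : Fin k × ∀ t, X t) (t : Fin k) (y : X t) :
    0 ≤ G.hideKer s t y := by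
  unfold hideKer
  split_ifs
  exacts [revealKer_nonneg _ _ _, G.condProb_nonneg _ _ _, revealKer_nonneg _ _ _]

theorem sum_hideKer (G : Game k X A) (s : Fin k × ∀ t, X t) (t : Fin k) :
    ∑ y, G.hideKer s t y = 1 := by
  unfold hideKer
  split_ifs with h h'
  exacts [sum_revealKer _ _, G.sum_condProb t h', sum_revealKer _ _]

theorem hideWeight_nonneg (G : Game k X A) (s : Fin k × ∀ t, X t) : 0 ≤ G.hideWeight s :=
  div_nonneg (G.μ_nonneg _) k.cast_nonneg

theorem sum_hideWeight (G : Game k X A) (hk : 1 ≤ k) : ∑ s, G.hideWeight s = 1 := by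
  have hk' : (k : ℝ) ≠ 0 := by positivity
  simp only [hideWeight, Fintype.sum_prod_type, ← Finset.sum_div, G.μ_sum]
  simp [hk']

theorem sum_hideWeight_mul_prod_revealKer (G : Game k X A) (hk : 1 ≤ k) (x : ∀ t, X t) :
    ∑ s, G.hideWeight s * ∏ t, revealKer s t (x t) = G.μ x := by
  have hk' : (k : ℝ) ≠ 0 := by positivity
  simp only [prod_revealKer, hideWeight, Fintype.sum_prod_type]
  simp
  field_simp

open scoped Classical in
theorem prod_hideKer (G : Game k X A) (t : Fin k) {z : ∀ t, X t} (hz : G.μ z ≠ 0) (x : ∀ t, X t) :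
    ∏ u, G.hideKer (t, z) u (x u) =
      if ∀ s, s ≠ t → x s = z s then G.condProb t z (x t) else 0 := by
  rw [← Finset.mul_prod_erase univ _ (mem_univ t)]
  have h1 : ∏ u ∈ univ.erase t, G.hideKer (t, z) u (x u) =
      ∏ u ∈ univ.erase t, if x u = z u then 1 else 0 :=
    Finset.prod_congr rfl fun u hu => by
      simp [hideKer, Finset.ne_of_mem_erase hu, revealKer]
  rw [h1, Finset.prod_ite_zero, Finset.prod_const_one]
  simp [hideKer, G.margExcept_ne_zero t hz]

theorem condProb_eq_of_agree (G : Game k X A) {t : Fin k} {x z : ∀ t, X t}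
    (h : ∀ s, s ≠ t → x s = z s) : G.condProb t z = G.condProb t x := by
  have : z = update x t (z t) := by
    funext s
    by_cases hs : s = t
    · subst hs
      simp
    · rw [update_of_ne hs, h s hs]
  rw [this, condProb_update]

theorem sum_hideWeight_mul_prod_hideKer (G : Game k X A) (hk : 1 ≤ k) (x : ∀ t, X t) :
    ∑ s, G.hideWeight s * ∏ t, G.hideKer s t (x t) = G.μ x := by
  classical
  have hk' : (k : ℝ) ≠ 0 := by positivity
  rw [Fintype.sum_prod_type]
  have : ∀ t, ∑ z, G.hideWeight (t, z) * ∏ u, G.hideKer (t, z) u (x u) = G.μ x / k := by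
    intro t
    have h1 : ∀ z, G.hideWeight (t, z) * ∏ u, G.hideKer (t, z) u (x u) =
        if ∀ s, s ≠ t → x s = z s then G.μ z / k * G.condProb t x (x t) else 0 := by
      intro z
      by_cases hz : G.μ z = 0
      · simp [hideWeight, hz]
      · rw [prod_hideKer G t hz, hideWeight]
        split_ifs with h
        · rw [condProb_eq_of_agree G h]
        · simp
    simp_rw [h1]
    rw [sum_ite_agree t x fun z => G.μ z / k * G.condProb t x (x t), ← Finset.sum_mul,
      ← Finset.sum_div]
    change G.margExcept t x / k * _ = _
    rw [div_mul_eq_mul_div, margExcept_mul_condProb, update_eq_self]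
  simp [this]
  field_simp

/-- An edge of the connection graph joins two tuples that are drawn independently, given a player
and the questions of the others. -/
theorem rho_eq_mixture (G : Game k X A) (x x' : ∀ t, X t) :
    G.rho x x' = ∑ s, G.hideWeight s *
      ((∏ t, G.hideKer s t (x t)) * ∏ t, G.hideKer s t (x' t)) := by
  classical
  rw [rho_eq_sum, Fintype.sum_prod_type]
  refine Finset.sum_congr rfl fun t _ => ?_
  have h1 : ∀ z, G.hideWeight (t, z) *
      ((∏ u, G.hideKer (t, z) u (x u)) * ∏ u, G.hideKer (t, z) u (x' u)) =
      if ∀ s, s ≠ t → x s = z s then (if ∀ s, s ≠ t → x s = x' s then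
        G.μ z / k * (G.condProb t x (x t) * G.condProb t x (x' t)) else 0) else 0 := by
    intro z
    by_cases hz : G.μ z = 0
    · simp [hideWeight, hz]
    · rw [prod_hideKer G t hz, prod_hideKer G t hz, hideWeight]
      by_cases h : ∀ s, s ≠ t → x s = z s
      · have h2 : (∀ s, s ≠ t → x' s = z s) ↔ ∀ s, s ≠ t → x s = x' s :=
          forall₂_congr fun s hs => by rw [h s hs, eq_comm]
        rw [if_pos h, if_pos h, if_congr h2 rfl rfl, condProb_eq_of_agree G h]
        split_ifs <;> simp
      · simp [h]
  simp_rw [h1]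
  rw [sum_ite_agree t x fun z => if ∀ s, s ≠ t → x s = x' s then
        G.μ z / k * (G.condProb t x (x t) * G.condProb t x (x' t)) else 0]
  split_ifs
  · rw [← Finset.sum_mul, ← Finset.sum_div]
    change _ = G.margExcept t x / k * _
    have := G.margExcept_mul_condProb t x (x t)
    rw [update_eq_self] at this
    rw [← this]
    ring
  · simp

end graph

end Game

/-! ### Conditioning on winning a set of coordinates -/

/-- Averaging over the latent variables gives back the product of the question distributions. -/
theorem sum_prod_mul_wsum {ι S W : Type*} [Fintype ι] [DecidableEq ι] [Fintype S] [Fintype W]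
    {ν : S → ℝ} {κ : ι → S → W → ℝ} {μ : W → ℝ} (h : ∀ j x, ∑ s, ν s * κ j s x = μ x)
    (F : (ι → W) → ℝ) :
    ∑ s : ι → S, (∏ j, ν (s j)) * wsum (fun j => κ j (s j)) F = ∑ x, (∏ j, μ (x j)) * F x := by
  simp only [wsum, Finset.mul_sum]
  rw [Finset.sum_comm]
  refine Finset.sum_congr rfl fun x _ => ?_
  simp_rw [← mul_assoc, ← Finset.prod_mul_distrib]
  rw [← Finset.sum_mul, ← Fintype.prod_sum fun j s => ν s * κ j s (x j)]
  simp [h]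

/-- Splitting an event into finitely many parts (here, by the answers given) increases the entropy
function by at most the logarithm of their number. -/
theorem sum_negMulLog_le {α : Type*} [Fintype α] [Nonempty α] {p : α → ℝ} (hp : ∀ a, 0 ≤ p a) :
    ∑ a, Real.negMulLog (p a) ≤
      Real.negMulLog (∑ a, p a) + (∑ a, p a) * Real.log (Fintype.card α) := by
  have hN : (0 : ℝ) < Fintype.card α := by exact_mod_cast Fintype.card_pos
  have h := sum_mul_negMulLog_le (w := fun _ : α => 1 / (Fintype.card α : ℝ))
    (fun _ => by positivity) (by simp) hp
  rw [← Finset.mul_sum, ← Finset.mul_sum] at h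
  set P := ∑ a, p a
  have hP : 0 ≤ P := Finset.sum_nonneg fun a _ => hp a
  have h2 : Real.negMulLog (1 / (Fintype.card α : ℝ) * P) =
      1 / (Fintype.card α : ℝ) * (Real.negMulLog P + P * Real.log (Fintype.card α)) := by
    rcases hP.eq_or_lt with h0 | h0
    · rw [← h0]
      simp
    · rw [Real.negMulLog, Real.negMulLog, Real.log_mul (by positivity) h0.ne', one_div, Real.log_inv]
      ring
  rw [h2] at h
  exact le_of_mul_le_mul_left h (by positivity)

namespace Game

variable {k : ℕ} {X : Fin k → Type u} {A : Fin k → Type v} [∀ t, Fintype (X t)]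

/-- The players win the coordinates in `C`, on the question tuples `x`. -/
def Wins (G : Game k X A) {n : ℕ} (f : ∀ t, (Fin n → X t) → Fin n → A t) (C : Finset (Fin n))
    (x : Fin n → ∀ t, X t) : Prop :=
  ∀ j ∈ C, G.V (x j) (fun t => f t (fun i => x i t) j) = true

open scoped Classical in
/-- The probability of winning all coordinates in `C` of the repeated game. -/
noncomputable def winOn (G : Game k X A) {n : ℕ} (f : ∀ t, (Fin n → X t) → Fin n → A t)
    (C : Finset (Fin n)) : ℝ :=
  ∑ x : Fin n → ∀ t, X t, (∏ j, G.μ (x j)) * (if G.Wins f C x then 1 else 0)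

theorem winOn_anti (G : Game k X A) {n : ℕ} (f : ∀ t, (Fin n → X t) → Fin n → A t)
    {C D : Finset (Fin n)} (h : C ⊆ D) : G.winOn f D ≤ G.winOn f C := by
  refine Finset.sum_le_sum fun x _ => mul_le_mul_of_nonneg_left ?_
    (Finset.prod_nonneg fun j _ => G.μ_nonneg _)
  by_cases hD : G.Wins f D x
  · rw [if_pos hD, if_pos (show G.Wins f C x from fun j hj => hD j (h hj))]
  · rw [if_neg hD]
    split_ifs <;> norm_num

theorem winOn_empty (G : Game k X A) {n : ℕ} (f : ∀ t, (Fin n → X t) → Fin n → A t) :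
    G.winOn f ∅ = 1 := by
  simp only [winOn, Wins]
  simp
  rw [← Fintype.prod_sum fun (_ : Fin n) x => G.μ x]
  simp [G.μ_sum]

theorem rep_winProb (G : Game k X A) {n : ℕ} (f : ∀ t, (Fin n → X t) → Fin n → A t) :
    (G.rep n).winProb f = G.winOn f univ := by
  refine Fintype.sum_equiv (Equiv.piComm fun (t : Fin k) (_ : Fin n) => X t) _ _ fun x => ?_
  simp only [rep, Wins, decide_eq_true_eq, mem_univ, true_imp_iff]
  rfl

variable [∀ t, Fintype (A t)]

/-- Conditioned on winning the coordinates in `C`, the average winning probability of the other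
coordinates exceeds the value of the base game by little, unless winning `C` is very unlikely. -/
theorem sum_winOn_insert_le [∀ t, Nonempty (A t)] (G : Game k X A) (hk : 1 ≤ k) {L : ℝ}
    (hL : 0 < L) (hP : G.Poincare G.rho L) {n : ℕ} (f : ∀ t, (Fin n → X t) → Fin n → A t)
    (C : Finset (Fin n)) {θ : ℝ} (hθ : 0 < θ) :
    ∑ i ∈ Cᶜ, G.winOn f (insert i C) ≤ (1 + θ) * (Cᶜ : Finset (Fin n)).card * G.val * G.winOn f C +
      (1 + 1 / θ) * (2 / L) * (Real.negMulLog (G.winOn f C) +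
        G.winOn f C * (C.card * Real.log (Fintype.card (∀ t, A t)))) := by
  classical
  have : Nonempty (Fin k) := ⟨⟨0, hk⟩⟩
  -- in the coordinates in `C`, the latent variable reveals all questions, and thereby whether the
  -- answers `a` are accepted
  set q : Fin n → (Fin k × ∀ t, X t) → ∀ t, X t → ℝ := fun j s t y =>
    if j ∈ C then revealKer s t y else G.hideKer s t y with hq
  set e : (C → ∀ t, A t) → (Fin n → Fin k × ∀ t, X t) → ∀ t, (Fin n → X t) → ℝ := fun a s t v =>
    (if ∀ j : C, f t v j = a j t then 1 else 0) *
      (if ∀ j : C, G.V (s j).2 (a j) = true then 1 else 0) with he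
  have hqμ : ∀ j x, ∑ s, G.hideWeight s * ∏ t, q j s t (x t) = G.μ x := by
    intro j x
    simp only [hq]
    split_ifs
    exacts [G.sum_hideWeight_mul_prod_revealKer hk x, G.sum_hideWeight_mul_prod_hideKer hk x]
  have hq0 : ∀ j s t y, 0 ≤ q j s t y := by
    intro j s t y
    simp only [hq]
    split_ifs
    exacts [revealKer_nonneg _ _ _, G.hideKer_nonneg _ _ _]
  have hq1 : ∀ j s t, ∑ y, q j s t y = 1 := by
    intro j s t
    simp only [hq]
    split_ifs
    exacts [sum_revealKer _ _, G.sum_hideKer _ _]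
  have he0 : ∀ a s t v, 0 ≤ e a s t v := by
    intro a s t v
    simp only [he]
    split_ifs <;> norm_num
  have he1 : ∀ a s t v, e a s t v ≤ 1 := by
    intro a s t v
    simp only [he]
    split_ifs <;> norm_num
  have hPq : ∀ i ∈ Cᶜ, G.Poincare (fun x x' => ∑ s, G.hideWeight s *
      ((∏ t, q i s t (x t)) * ∏ t, q i s t (x' t))) L := by
    intro i hi
    simpa only [hq, if_neg (Finset.mem_compl.1 hi), ← rho_eq_mixture] using hP
  have heI : ∀ a, ∀ i ∈ Cᶜ, ∀ s b, e a (update s i b) = e a s := by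
    intro a i hi s b
    have h : ∀ j : C, update s i b j = s j := fun j =>
      update_of_ne (ne_of_mem_of_not_mem j.2 (Finset.mem_compl.1 hi)) _ _
    simp only [he, h]
  set p : (C → ∀ t, A t) → ℝ := fun a => ∑ s : Fin n → Fin k × ∀ t, X t, (∏ j, G.hideWeight (s j)) *
    wsum (fun j (x : ∀ t, X t) => ∏ t, q j (s j) t (x t))
      (fun x => ∏ t, e a s t (fun j => x j t)) with hp
  have hp0 : ∀ a, 0 ≤ p a := fun a => Finset.sum_nonneg fun s _ =>
    mul_nonneg (Finset.prod_nonneg fun j _ => G.hideWeight_nonneg _)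
      (wsum_nonneg (fun j x => Finset.prod_nonneg fun t _ => hq0 _ _ _ _)
        fun x => Finset.prod_nonneg fun t _ => he0 _ _ _ _)
  -- the answers given in `C` are determined by the questions, and only accepted ones are counted
  have hsum : ∀ F : (Fin n → ∀ t, X t) → ℝ,
      ∑ a, ∑ s : Fin n → Fin k × ∀ t, X t, (∏ j, G.hideWeight (s j)) *
        wsum (fun j (x : ∀ t, X t) => ∏ t, q j (s j) t (x t))
          (fun x => (∏ t, e a s t (fun j => x j t)) * F x) =
      ∑ x, (∏ j, G.μ (x j)) * ((if G.Wins f C x then 1 else 0) * F x) := by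
    intro F
    have hlat := @sum_prod_mul_wsum (Fin n) (Fin k × ∀ t, X t) (∀ t, X t) _ _ _ _ G.hideWeight
      (fun j s x => ∏ t, q j s t (x t)) G.μ hqμ fun x => (if G.Wins f C x then 1 else 0) * F x
    rw [← hlat, Finset.sum_comm]
    refine Finset.sum_congr rfl fun s _ => ?_
    rw [← Finset.mul_sum]
    congr 1
    simp only [wsum]
    rw [Finset.sum_comm]
    refine Finset.sum_congr rfl fun x _ => ?_
    rw [← Finset.mul_sum]
    by_cases h0 : ∏ j, ∏ t, q j (s j) t (x j t) = 0
    · rw [h0, zero_mul, zero_mul]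
    congr 1
    rw [← Finset.sum_mul]
    congr 1
    have hx : ∀ j ∈ C, x j = (s j).2 := by
      intro j hj
      have h1 := Finset.prod_ne_zero_iff.1 h0 j (mem_univ j)
      simp only [hq, if_pos hj, prod_revealKer] at h1
      by_contra h
      simp [h] at h1
    have he' : ∀ a, ∏ t, e a s t (fun j => x j t) =
        (if (fun (j : C) t => f t (fun i => x i t) j) = a then 1 else 0) *
          (if ∀ j : C, G.V (s j).2 (a j) = true then 1 else 0) := by
      intro a
      simp only [he]
      rw [Finset.prod_mul_distrib, Finset.prod_ite_zero, Finset.prod_ite_zero,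
        Finset.prod_const_one]
      congr 1
      · by_cases h : (fun (j : C) t => f t (fun i => x i t) j) = a
        · rw [if_pos h, if_pos fun t _ j => congrFun (congrFun h j) t]
        · rw [if_neg h, if_neg fun h' => h (funext fun j => funext fun t => h' t (mem_univ t) j)]
      · by_cases h : ∀ j : C, G.V (s j).2 (a j) = true
        · rw [if_pos h, if_pos fun _ _ => h]
        · rw [if_neg h, if_neg fun h' => h (h' ⟨0, hk⟩ (mem_univ _))]
    simp_rw [he']
    rw [Finset.sum_eq_single (fun (j : C) t => f t (fun i => x i t) j)
      (fun a _ ha => by simp [ha.symm]) (by simp), if_pos rfl, one_mul]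
    refine if_congr ?_ rfl rfl
    constructor
    · intro h j hj
      rw [hx j hj]
      exact h ⟨j, hj⟩
    · intro h j
      rw [← hx j j.2]
      exact h j j.2
  have hpsum : ∑ a, p a = G.winOn f C := by
    have := hsum fun _ => 1
    simp only [mul_one] at this
    exact this
  have hins : ∀ i, ∑ a, ∑ s : Fin n → Fin k × ∀ t, X t, (∏ j, G.hideWeight (s j)) *
        wsum (fun j (x : ∀ t, X t) => ∏ t, q j (s j) t (x t))
          (fun x => (∏ t, e a s t (fun j => x j t)) *
            (if G.V (x i) (fun t => f t (fun j => x j t) i) = true then 1 else 0)) =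
      G.winOn f (insert i C) := by
    intro i
    rw [hsum]
    refine Finset.sum_congr rfl fun x _ => ?_
    congr 1
    have : G.Wins f (insert i C) x ↔
        G.Wins f C x ∧ G.V (x i) (fun t => f t (fun j => x j t) i) = true := by
      simp only [Wins, Finset.forall_mem_insert]
      exact and_comm
    simp only [this, ite_and, ite_mul, one_mul, zero_mul]
  have hcore := fun a => G.sum_win_le_of_mixture G.hideWeight_nonneg (G.sum_hideWeight hk) hq0 hq1 hqμ hL hPq
    (he0 a) (he1 a) (heI a) f hθ (p := p a) rfl
  have hfin := Finset.sum_le_sum fun a (_ : a ∈ univ) => hcore a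
  rw [Finset.sum_comm] at hfin
  simp_rw [hins] at hfin
  refine hfin.trans ?_
  rw [Finset.sum_add_distrib, ← Finset.mul_sum, ← Finset.mul_sum, hpsum]
  have hent := sum_negMulLog_le hp0
  rw [hpsum, Fintype.card_fun, Fintype.card_coe, Nat.cast_pow, Real.log_pow] at hent
  have : 0 ≤ (1 + 1 / θ) * (2 / L) := by positivity
  linarith [mul_le_mul_of_nonneg_left hent this]

end Game

/-! ### Exponential decay from a Poincaré inequality -/

namespace Game

variable {k : ℕ} {X : Fin k → Type u} {A : Fin k → Type v} [∀ t, Fintype (X t)]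
  [∀ t, Fintype (A t)]

/-- While `-log (winOn f C)` and the entropy of the answers in `C` are small compared to the number of
coordinates left, some coordinate outside `C` is lost with probability at least `ε / 2`, given that
those in `C` are won. -/
theorem exists_winOn_insert_le [∀ t, Nonempty (A t)] (G : Game k X A) (hk : 1 ≤ k) {L : ℝ}
    (hL : 0 < L) (hP : G.Poincare G.rho L) {ε : ℝ} (hε : 0 < ε) (hε1 : ε ≤ 1) (hval : G.val ≤ 1 - ε)
    {n : ℕ} (f : ∀ t, (Fin n → X t) → Fin n → A t) {C : Finset (Fin n)} (hp : 0 < G.winOn f C)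
    {D : ℝ} (hD : -Real.log (G.winOn f C) ≤ D) (hm : (Cᶜ : Finset (Fin n)).Nonempty)
    (hCD : C.card * Real.log (Fintype.card (∀ t, A t)) + D ≤
      ε ^ 2 * L * (Cᶜ : Finset (Fin n)).card / 40) :
    ∃ i ∈ Cᶜ, G.winOn f (insert i C) ≤ (1 - ε / 2) * G.winOn f C := by
  apply Finset.exists_le_of_sum_le hm
  -- `θ = ε / 4` leaves `(1 + θ) (1 - ε) ≤ 1 - 3 ε / 4`
  refine (G.sum_winOn_insert_le hk hL hP f C (θ := ε / 4) (by positivity)).trans ?_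
  rw [Finset.sum_const, nsmul_eq_mul]
  set p := G.winOn f C
  set m : ℝ := ((Cᶜ : Finset (Fin n)).card : ℝ) with hm'
  have hm0 : 0 ≤ m := Nat.cast_nonneg _
  have h1 : (1 + ε / 4) * m * G.val * p ≤ (1 - 3 * ε / 4) * (m * p) := by
    have h2 : (1 + ε / 4) * G.val ≤ 1 - 3 * ε / 4 := by nlinarith
    have := mul_le_mul_of_nonneg_right h2 (mul_nonneg hm0 hp.le)
    linarith
  have h3 : (1 + 1 / (ε / 4)) * (2 / L) ≤ 10 / (ε * L) := by
    have h7 : 1 + 1 / (ε / 4) = (ε + 4) / ε := by field_simp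
    rw [h7, div_mul_div_comm]
    gcongr
    linarith
  have h4 : Real.negMulLog p + p * (C.card * Real.log (Fintype.card (∀ t, A t))) ≤
      p * (ε ^ 2 * L * m / 40) := by
    rw [Real.negMulLog]
    nlinarith
  have h5 : (1 + 1 / (ε / 4)) * (2 / L) * (Real.negMulLog p +
      p * (C.card * Real.log (Fintype.card (∀ t, A t)))) ≤
      10 / (ε * L) * (p * (ε ^ 2 * L * m / 40)) := by
    refine (mul_le_mul_of_nonneg_left h4 (by positivity)).trans ?_
    exact mul_le_mul_of_nonneg_right h3 (by positivity)
  have h6 : 10 / (ε * L) * (p * (ε ^ 2 * L * m / 40)) = ε / 4 * (m * p) := by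
    field_simp
    ring
  linarith

theorem pow_one_sub_le_exp {a : ℝ} (ha : a ≤ 1) (s : ℕ) : (1 - a) ^ s ≤ Real.exp (-(a * s)) := by
  have h := Real.add_one_le_exp (-a)
  calc (1 - a) ^ s ≤ Real.exp (-a) ^ s := pow_le_pow_left₀ (by linarith) (by linarith) s
    _ = Real.exp (-(a * s)) := by
      rw [← Real.exp_nat_mul]
      congr 1
      ring

/-- If the connection graph satisfies a Poincaré inequality, the value of the repeated game decays
exponentially. The set of conditioned coordinates is grown greedily: as long as winning it is not
too unlikely, some further coordinate is lost with probability at least `ε / 2`. -/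
theorem val_rep_le (G : Game k X A) (hk : 1 ≤ k) {L : ℝ} (hL : 0 < L) (hL1 : L ≤ 1)
    (hP : G.Poincare G.rho L) {ε : ℝ} (hε : 0 < ε) (hval : G.val ≤ 1 - ε)
    (hA : 2 ≤ Fintype.card (∀ t, A t)) (n : ℕ) :
    (G.rep n).val ≤ Real.exp (-(ε ^ 5 * L * n / (640 * Real.log (Fintype.card (∀ t, A t))))) := by
  have hne : Nonempty (∀ t, A t) := Fintype.card_pos_iff.1 (by omega)
  have hneA : ∀ t, Nonempty (A t) := fun t => ⟨hne.some t⟩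
  have hε1 : ε ≤ 1 := by linarith [G.val_nonneg]
  set ℓ := Real.log (Fintype.card (∀ t, A t)) with hℓ
  have hℓ2 : 1 / 2 < ℓ := by
    have h1 : Real.log 2 ≤ ℓ := Real.log_le_log two_pos (by exact_mod_cast hA)
    linarith [Real.log_two_gt_d9]
  refine ciSup_le fun f => ?_
  rcases Nat.eq_zero_or_pos n with rfl | hn
  · simpa using (G.rep 0).winProb_le_one f
  have hn' : (0 : ℝ) < n := by exact_mod_cast hn
  rw [rep_winProb]
  set y := ε ^ 2 * L * n / (160 * ℓ) with hy
  have hy0 : 0 < y := by positivity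
  have hyℓ : y * ℓ = ε ^ 2 * L * n / 160 := by
    rw [hy]
    field_simp
  have hexp : ε ^ 5 * L * n / (640 * ℓ) = ε ^ 3 * y / 4 := by
    rw [hy]
    field_simp
    ring
  rw [hexp]
  have hε2 : ε ^ 2 ≤ 1 := pow_le_one₀ hε.le hε1
  have hε3 : ε ^ 3 ≤ ε := by nlinarith
  have hε3y : ε ^ 3 * y ≤ ε * y := mul_le_mul_of_nonneg_right hε3 hy0.le
  rcases lt_or_ge y 1 with hy1 | hy1
  · -- here the bound is so weak that losing a single coordinate suffices
    have hne' : ((∅ : Finset (Fin n))ᶜ).Nonempty := ⟨⟨0, hn⟩, by simp⟩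
    obtain ⟨i, -, hi⟩ := G.exists_winOn_insert_le hk hL hP hε hε1 hval f (C := ∅) (D := 0)
      (by rw [winOn_empty]; exact one_pos) (by rw [winOn_empty]; simp) hne'
      (by simp; positivity)
    rw [winOn_empty, mul_one] at hi
    refine (G.winOn_anti f (subset_univ _)).trans (hi.trans ?_)
    refine le_trans ?_ (Real.exp_le_exp.2 (show -(ε / 2) ≤ _ from ?_))
    · linarith [Real.add_one_le_exp (-(ε / 2))]
    · nlinarith
  · rcases le_or_gt (G.winOn f univ) (Real.exp (-(y * ℓ))) with hD | hD
    · refine hD.trans (Real.exp_le_exp.2 ?_)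
      nlinarith
    have hyn : y ≤ n / 80 := by
      rw [hy, div_le_div_iff₀ (by positivity) (by norm_num)]
      have : ε ^ 2 * L ≤ 1 := mul_le_one₀ hε2 hL.le hL1
      nlinarith
    have key : ∀ s : ℕ, s ≤ ⌊y⌋₊ → ∃ C : Finset (Fin n), C.card = s ∧
        G.winOn f C ≤ (1 - ε / 2) ^ s := by
      intro s
      induction s with
      | zero => exact fun _ => ⟨∅, rfl, by rw [winOn_empty, pow_zero]⟩
      | succ s ih =>
        intro hs
        obtain ⟨C, hC, hCs⟩ := ih (by omega)
        have hsy : (s : ℝ) ≤ y :=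
          (Nat.cast_le.2 (Nat.le_of_succ_le hs)).trans (Nat.floor_le hy0.le)
        have hlt : Real.exp (-(y * ℓ)) < G.winOn f C := hD.trans_le (G.winOn_anti f (subset_univ C))
        have hpos : 0 < G.winOn f C := (Real.exp_pos _).trans hlt
        have hcard : ((Cᶜ : Finset (Fin n)).card : ℝ) = n - s := by
          rw [Finset.card_compl, Fintype.card_fin, Nat.cast_sub, hC]
          simpa using Finset.card_le_univ C
        have hCne : (Cᶜ : Finset (Fin n)).Nonempty := by
          rw [← Finset.card_pos, ← Nat.cast_pos (α := ℝ), hcard]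
          linarith
        obtain ⟨i, hi, hwin⟩ := G.exists_winOn_insert_le hk hL hP hε hε1 hval f hpos (D := y * ℓ)
          (by linarith [(Real.lt_log_iff_exp_lt hpos).2 hlt]) hCne (by
            rw [hcard, hC]
            have h1 : (s : ℝ) * ℓ ≤ y * ℓ := mul_le_mul_of_nonneg_right hsy (by linarith)
            have h2 : ε ^ 2 * L * (n / 2) ≤ ε ^ 2 * L * (n - s) :=
              mul_le_mul_of_nonneg_left (by linarith) (by positivity)
            linarith)
        refine ⟨insert i C, by rw [Finset.card_insert_of_notMem (Finset.mem_compl.1 hi), hC], ?_⟩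
        rw [pow_succ']
        exact hwin.trans (mul_le_mul_of_nonneg_left hCs (by linarith))
    obtain ⟨C, -, hC⟩ := key ⌊y⌋₊ le_rfl
    refine (G.winOn_anti f (subset_univ C)).trans (hC.trans
      ((pow_one_sub_le_exp (by linarith) _).trans (Real.exp_le_exp.2 ?_)))
    have h1 : (1 : ℝ) ≤ ⌊y⌋₊ := by exact_mod_cast Nat.le_floor (by exact_mod_cast hy1)
    have h2 := Nat.lt_floor_add_one y
    nlinarith

end Game

/-! ### The Efron–Stein inequality -/

theorem sum_mul_sub_mean_sq {W : Type*} [Fintype W] {μ : W → ℝ} (hμ : ∑ x, μ x = 1) (h : W → ℝ)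
    (c : ℝ) : ∑ x, μ x * (h x - c) ^ 2 =
      ∑ x, μ x * (h x - ∑ y, μ y * h y) ^ 2 + (∑ y, μ y * h y - c) ^ 2 := by
  set m := ∑ y, μ y * h y with hm
  have h1 : ∀ x, μ x * (h x - c) ^ 2 =
      μ x * (h x - m) ^ 2 + (2 * (m - c) * (μ x * h x) + μ x * ((m - c) ^ 2 - 2 * (m - c) * m)) :=
    fun x => by ring
  simp_rw [h1, Finset.sum_add_distrib, ← Finset.mul_sum, ← Finset.sum_mul, hμ, ← hm]
  ring

theorem sum_mul_sub_mean_sq_eq {W : Type*} [Fintype W] {μ : W → ℝ} (hμ : ∑ x, μ x = 1)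
    (h : W → ℝ) : ∑ x, μ x * (h x - ∑ y, μ y * h y) ^ 2 =
      1 / 2 * ∑ x, ∑ y, μ x * (μ y * (h x - h y) ^ 2) := by
  have h1 : ∀ x, ∑ y, μ x * (μ y * (h x - h y) ^ 2) =
      μ x * (∑ y, μ y * (h y - ∑ z, μ z * h z) ^ 2 + (∑ y, μ y * h y - h x) ^ 2) := by
    intro x
    rw [← sum_mul_sub_mean_sq hμ h (h x), Finset.mul_sum]
    exact Finset.sum_congr rfl fun y _ => by ring
  simp_rw [h1, mul_add, Finset.sum_add_distrib, ← Finset.sum_mul, hμ]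
  have h2 : ∀ x, μ x * (∑ y, μ y * h y - h x) ^ 2 = μ x * (h x - ∑ y, μ y * h y) ^ 2 :=
    fun x => by ring
  simp_rw [h2]
  ring

/-- The Efron–Stein inequality for a product of finite probability weights. -/
theorem efron_stein : ∀ {k : ℕ} {X : Fin k → Type u} [∀ t, Fintype (X t)] {ν : ∀ t, X t → ℝ}
    (_ : ∀ t y, 0 ≤ ν t y) (_ : ∀ t, ∑ y, ν t y = 1) (h : (∀ t, X t) → ℝ),
    ∑ x, (∏ t, ν t (x t)) * (h x - ∑ y, (∏ t, ν t (y t)) * h y) ^ 2 ≤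
      1 / 2 * ∑ t, ∑ x, (∏ s, ν s (x s)) * ∑ y, ν t y * (h x - h (update x t y)) ^ 2 := by
  intro k
  induction k with
  | zero =>
    intro X _ ν _ _ h
    simp
  | succ k ih =>
    intro X _ ν hν hν1 h
    set P : (∀ t : Fin k, X t.succ) → ℝ := fun b => ∏ t, ν t.succ (b t) with hP
    -- integrate over the first coordinate and over the others
    have hsum : ∀ F : (∀ t, X t) → ℝ, ∑ x, (∏ t, ν t (x t)) * F x =
        ∑ b, P b * ∑ a, ν 0 a * F (Fin.cons a b) := by
      intro F
      rw [← (Fin.consEquiv X).sum_comp, Fintype.sum_prod_type, Finset.sum_comm]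
      refine Finset.sum_congr rfl fun b _ => ?_
      rw [Finset.mul_sum]
      refine Finset.sum_congr rfl fun a _ => ?_
      simp [hP, Fin.consEquiv, Fin.prod_univ_succ]
      ring
    have hP0 : ∀ b, 0 ≤ P b := fun b => Finset.prod_nonneg fun t _ => hν _ _
    have hP1 : ∑ b, P b = 1 := by
      rw [hP, ← Fintype.prod_sum fun (t : Fin k) (y : X t.succ) => ν t.succ y]
      exact Finset.prod_eq_one fun t _ => hν1 _
    set g : (∀ t : Fin k, X t.succ) → ℝ := fun b => ∑ a, ν 0 a * h (Fin.cons a b) with hg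
    have hih : ∑ b, P b * (g b - ∑ b, P b * g b) ^ 2 ≤ 1 / 2 * ∑ t, ∑ b, P b *
        ∑ y, ν (Fin.succ t) y * (g b - g (update b t y)) ^ 2 :=
      ih (fun t : Fin k => hν t.succ) (fun t => hν1 t.succ) g
    have hmean : ∑ x, (∏ t, ν t (x t)) * h x = ∑ b, P b * g b := hsum h
    rw [hmean, hsum fun x => (h x - _) ^ 2, Fin.sum_univ_succ]
    have hv : ∀ b, ∑ a, ν 0 a * (h (Fin.cons a b) - ∑ b, P b * g b) ^ 2 =
        1 / 2 * ∑ a, ∑ a', ν 0 a * (ν 0 a' * (h (Fin.cons a b) - h (Fin.cons a' b)) ^ 2) +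
          (g b - ∑ b, P b * g b) ^ 2 := by
      intro b
      rw [sum_mul_sub_mean_sq (hν1 0) fun a => h (Fin.cons a b),
        sum_mul_sub_mean_sq_eq (hν1 0) fun a => h (Fin.cons a b)]
    simp_rw [hv, mul_add, Finset.sum_add_distrib]
    refine add_le_add (le_of_eq ?_) (hih.trans ?_)
    · rw [hsum, Finset.mul_sum]
      refine Finset.sum_congr rfl fun b _ => ?_
      rw [mul_left_comm]
      congr 2
      refine Finset.sum_congr rfl fun a _ => ?_
      rw [Finset.mul_sum]
      simp
    · refine mul_le_mul_of_nonneg_left (Finset.sum_le_sum fun t _ => ?_) (by norm_num)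
      rw [hsum]
      refine Finset.sum_le_sum fun b _ => mul_le_mul_of_nonneg_left ?_ (hP0 b)
      simp_rw [Finset.mul_sum]
      rw [Finset.sum_comm]
      refine Finset.sum_le_sum fun y _ => ?_
      have hj := (Even.convexOn_pow (𝕜 := ℝ) even_two).map_sum_le (t := univ) (w := ν 0)
        (p := fun a => h (Fin.cons a b) - h (Fin.cons a (update b t y)))
        (fun a _ => hν 0 a) (hν1 0) fun _ _ => Set.mem_univ _
      simp only [smul_eq_mul, mul_sub, Finset.sum_sub_distrib] at hj
      refine (mul_le_mul_of_nonneg_left hj (hν _ y)).trans (le_of_eq ?_)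
      rw [Finset.mul_sum]
      refine Finset.sum_congr rfl fun a _ => ?_
      rw [Fin.cons_update]
      ring

namespace Game

variable {k : ℕ} {X : Fin k → Type u} {A : Fin k → Type v} [∀ t, Fintype (X t)]

/-! ### Free games -/

theorem mul_condProb_eq_of_prod {G : Game k X A} {ν : ∀ t, X t → ℝ} (hν1 : ∀ t, ∑ y, ν t y = 1)
    (hμ : ∀ x, G.μ x = ∏ t, ν t (x t)) (t : Fin k) (x : ∀ t, X t) (y : X t) :
    G.μ x * G.condProb t x y = G.μ x * ν t y := by
  by_cases hx : G.μ x = 0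
  · simp [hx]
  congr 1
  have h := G.margExcept_mul_condProb t x y
  have h1 : ∀ z, G.μ (update x t z) = ν t z * ∏ s ∈ univ.erase t, ν s (x s) := by
    intro z
    rw [hμ, ← Finset.mul_prod_erase univ _ (mem_univ t), update_self]
    congr 1
    exact Finset.prod_congr rfl fun s hs => by rw [update_of_ne (Finset.ne_of_mem_erase hs)]
  have h2 : G.margExcept t x = ∏ s ∈ univ.erase t, ν s (x s) := by
    simp only [margExcept, h1]
    rw [← Finset.sum_mul, hν1, one_mul]
  rw [h1, ← h2, mul_comm] at h
  exact mul_right_cancel₀ (G.margExcept_ne_zero t hx) h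

/-- For a free game, this is the Efron–Stein inequality. -/
theorem IsFree.poincare {G : Game k X A} (hk : 1 ≤ k) (hG : G.IsFree) :
    G.Poincare G.rho (1 / (k : ℝ) ^ 2) := by
  obtain ⟨ν, hν, hν1, hμ⟩ := hG
  intro h
  have hk' : (1 : ℝ) ≤ k := by exact_mod_cast hk
  have hES := efron_stein hν hν1 h
  simp_rw [← hμ] at hES
  rw [G.sum_rho_mul fun x x' => (h x - h x') ^ 2]
  have h1 : ∀ t x, G.μ x * ∑ y, ν t y * (h x - h (update x t y)) ^ 2 =
      G.μ x * ∑ y, G.condProb t x y * (h x - h (update x t y)) ^ 2 := by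
    intro t x
    simp_rw [Finset.mul_sum, ← mul_assoc, mul_condProb_eq_of_prod hν1 hμ]
  simp_rw [h1] at hES
  set V := ∑ x, G.μ x * (h x - ∑ y, G.μ y * h y) ^ 2
  set T := ∑ t, ∑ x, G.μ x * ∑ y, G.condProb t x y * (h x - h (update x t y)) ^ 2
  have hV : 0 ≤ V := Finset.sum_nonneg fun x _ => mul_nonneg (G.μ_nonneg x) (sq_nonneg _)
  rw [div_mul_eq_mul_div, div_mul_eq_mul_div, one_mul, one_mul,
    div_le_div_iff₀ (by positivity) (by positivity)]
  nlinarith [mul_le_mul_of_nonneg_right (show V ≤ T by linarith) (show (0 : ℝ) ≤ k by linarith),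
    mul_le_mul_of_nonneg_right hk' (mul_nonneg (show 0 ≤ T by linarith) (show (0 : ℝ) ≤ k by linarith))]

/-! ### Vector-valued functions -/

/-- The expansion is bounded below by the constant of a Poincaré inequality for scalar functions,
applied to the coordinates of a vector-valued function. -/
theorem Poincare.le_lam {G : Game k X A} (hk : 1 ≤ k) {L : ℝ} (hP : G.Poincare G.rho L) :
    ENNReal.ofReal L ≤ G.lam := by
  refine le_iInf fun r => le_iInf fun g => le_iInf fun hg => ENNReal.ofReal_le_ofReal ?_
  rw [le_div_iff₀ hg]
  have hmean : ∀ i, WGraph.mean G.rho g i = ∑ y, G.μ y * g y i := by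
    intro i
    simp [WGraph.mean, G.weight_rho hk]
  have hvar : WGraph.variance G.rho g =
      ∑ i, ∑ x, G.μ x * (g x i - ∑ y, G.μ y * g y i) ^ 2 := by
    simp only [WGraph.variance, G.weight_rho hk, EuclideanSpace.real_norm_sq_eq, Finset.mul_sum]
    rw [Finset.sum_comm]
    simp [hmean]
  have hen : WGraph.energy G.rho g = ∑ i, ∑ x, ∑ x', G.rho x x' * (g x i - g x' i) ^ 2 := by
    simp only [WGraph.energy, EuclideanSpace.real_norm_sq_eq, Finset.mul_sum]
    rw [Finset.sum_comm (s := univ (α := Fin r))]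
    refine Finset.sum_congr rfl fun x _ => ?_
    rw [Finset.sum_comm (s := univ (α := Fin r))]
    rfl
  rw [hvar, hen, Finset.mul_sum]
  exact Finset.sum_le_sum fun i _ => hP fun x => g x i

/-! ### Anchored games -/

/-- A change of the question of player `t` from `x t` to `b` is at least as likely if the question is
resampled given the other players' questions as if only the anchor is resampled given the original
questions: there is equality if one of the two questions is the anchor, and otherwise the second
probability is zero. -/
theorem anchored_edge_le (G : Game k X A) {α : ℝ} (h0 : 0 ≤ α) (h1 : α ≤ 1) (t : Fin k)
    (x : ∀ t, Option (X t)) {b : Option (X t)} (hb : b ≠ x t) :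
    ∑ y, G.μ y * ((∏ s, anchorProb α (y s) (x s)) * anchorProb α (y t) b) ≤
      (G.anchored α h0 h1).μ x * (G.anchored α h0 h1).condProb t x b := by
  set R : (∀ t, X t) → ℝ := fun y => G.μ y * ∏ s ∈ univ.erase t, anchorProb α (y s) (x s) with hR
  have hR0 : ∀ y, 0 ≤ R y := fun y => mul_nonneg (G.μ_nonneg y)
    (Finset.prod_nonneg fun s _ => anchorProb_nonneg h0 h1 _ _)
  have hμ : ∀ c, (G.anchored α h0 h1).μ (update x t c) = ∑ y, R y * anchorProb α (y t) c := by
    intro c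
    refine Finset.sum_congr rfl fun y _ => ?_
    rw [hR, ← Finset.mul_prod_erase univ _ (mem_univ t), update_self]
    have : ∏ s ∈ univ.erase t, anchorProb α (y s) (update x t c s) =
        ∏ s ∈ univ.erase t, anchorProb α (y s) (x s) :=
      Finset.prod_congr rfl fun s hs => by rw [update_of_ne (Finset.ne_of_mem_erase hs)]
    rw [this]
    ring
  have hx := hμ (x t)
  rw [update_eq_self] at hx
  have hZ : (G.anchored α h0 h1).margExcept t x = ∑ y, R y := by
    simp only [margExcept, hμ]
    rw [Finset.sum_comm]
    exact Finset.sum_congr rfl fun y _ => by rw [← Finset.mul_sum, anchorProb_sum, mul_one]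
  have hL : ∑ y, G.μ y * ((∏ s, anchorProb α (y s) (x s)) * anchorProb α (y t) b) =
      ∑ y, R y * (anchorProb α (y t) (x t) * anchorProb α (y t) b) := by
    refine Finset.sum_congr rfl fun y _ => ?_
    rw [hR, ← Finset.mul_prod_erase univ _ (mem_univ t)]
    ring
  rw [hL, hx, condProb, hμ, hZ]
  set Z := ∑ y, R y with hZ'
  have hnn : ∀ c, 0 ≤ ∑ y, R y * anchorProb α (y t) c := fun c =>
    Finset.sum_nonneg fun y _ => mul_nonneg (hR0 y) (anchorProb_nonneg h0 h1 _ _)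
  have hRHS : 0 ≤ (∑ y, R y * anchorProb α (y t) (x t)) *
      ((∑ y, R y * anchorProb α (y t) b) / Z) :=
    mul_nonneg (hnn _) (div_nonneg (hnn _) (Finset.sum_nonneg fun y _ => hR0 y))
  by_cases hZ0 : Z = 0
  · have hR' : ∀ y, R y = 0 := fun y =>
      (Finset.sum_eq_zero_iff_of_nonneg fun y _ => hR0 y).1 hZ0 y (mem_univ y)
    simp [hR']
  have hnone : ∀ y : X t, anchorProb α y none = α := fun y => by simp [anchorProb]
  cases b with
  | none =>
    simp only [hnone]
    rw [← Finset.sum_mul, mul_div_right_comm, div_self hZ0, one_mul, Finset.sum_mul]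
    exact le_of_eq (Finset.sum_congr rfl fun y _ => by ring)
  | some b =>
    cases hc : x t with
    | none =>
      simp only [hnone]
      rw [← Finset.sum_mul, ← mul_div_assoc, mul_right_comm, mul_assoc, mul_div_right_comm,
        ← hZ', div_self hZ0, one_mul, Finset.sum_mul]
      exact le_of_eq (Finset.sum_congr rfl fun y _ => by ring)
    | some c =>
      rw [hc] at hRHS
      refine le_trans (le_of_eq (Finset.sum_eq_zero fun y _ => ?_)) hRHS
      have hbc : b ≠ c := fun h => hb (by rw [hc, h])
      by_cases hyb : b = y t
      · have : ¬c = y t := fun h => hbc (hyb.trans h.symm)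
        simp [anchorProb, this]
      · simp [anchorProb, hyb]

/-- Given the original questions `y`, the anchored tuple has a product distribution, so the variance
over the anchors is controlled by Efron–Stein. This also controls the dependence on `y`, because
all values of `y` share the all-anchor tuple, which has probability `α ^ k`. -/
theorem anchored_poincare (G : Game k X A) (hk : 1 ≤ k) {α : ℝ} (h0 : 0 < α) (h1 : α < 1) :
    (G.anchored α h0.le h1.le).Poincare (G.anchored α h0.le h1.le).rho (α ^ k / (8 * k)) := by
  intro h
  set G' := G.anchored α h0.le h1.le with hG'
  have hk' : (1 : ℝ) ≤ k := by exact_mod_cast hk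
  set P : (∀ t, X t) → (∀ t, Option (X t)) → ℝ := fun y x => ∏ t, anchorProb α (y t) (x t) with hP
  have ha : ∀ (t : Fin k) (y : X t) b, 0 ≤ anchorProb α y b := fun t y b =>
    anchorProb_nonneg h0.le h1.le y b
  have hP0 : ∀ y x, 0 ≤ P y x := fun y x => Finset.prod_nonneg fun t _ => ha t _ _
  have hP1 : ∀ y, ∑ x, P y x = 1 := by
    intro y
    rw [hP, ← Fintype.prod_sum fun t b => anchorProb α (y t) b]
    exact Finset.prod_eq_one fun t _ => anchorProb_sum α (y t)
  set v : (∀ t, X t) → ℝ := fun y => ∑ x, P y x * (h x - ∑ z, P y z * h z) ^ 2 with hv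
  have hv0 : ∀ y, 0 ≤ v y := fun y => Finset.sum_nonneg fun x _ => mul_nonneg (hP0 y x) (sq_nonneg _)
  set z : ∀ t, Option (X t) := fun _ => none with hz
  -- the all-anchor tuple has probability `α ^ k` given any question tuple of the original game
  have hbot : ∀ y, α ^ k * (∑ x, P y x * h x - h z) ^ 2 ≤ v y := by
    intro y
    have h2 : P y z = α ^ k := by simp [hP, hz, anchorProb]
    rw [← h2, ← neg_sub, neg_sq]
    exact Finset.single_le_sum (f := fun x => P y x * (h x - ∑ z, P y z * h z) ^ 2)
      (fun x _ => mul_nonneg (hP0 y x) (sq_nonneg _)) (mem_univ z)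
  have hαk : α ^ k ≤ 1 := pow_le_one₀ h0.le h1.le
  have hαk0 : 0 < α ^ k := pow_pos h0 k
  set V := ∑ x, G'.μ x * (h x - ∑ y, G'.μ y * h y) ^ 2 with hV
  have hV0 : 0 ≤ V := Finset.sum_nonneg fun x _ => mul_nonneg (G'.μ_nonneg x) (sq_nonneg _)
  have hVv : α ^ k * V ≤ 2 * ∑ y, G.μ y * v y := by
    have h2 : V ≤ ∑ x, G'.μ x * (h x - h z) ^ 2 := by
      rw [sum_mul_sub_mean_sq G'.μ_sum h (h z)]
      exact le_add_of_nonneg_right (sq_nonneg _)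
    have h3 : ∑ x, G'.μ x * (h x - h z) ^ 2 =
        ∑ y, G.μ y * (v y + (∑ x, P y x * h x - h z) ^ 2) := by
      simp_rw [hv, ← sum_mul_sub_mean_sq (hP1 _) h (h z), Finset.mul_sum]
      rw [Finset.sum_comm]
      refine Finset.sum_congr rfl fun x _ => ?_
      simp only [hG', anchored]
      rw [Finset.sum_mul]
      exact Finset.sum_congr rfl fun y _ => by rw [mul_assoc]
    rw [h3] at h2
    refine (mul_le_mul_of_nonneg_left h2 hαk0.le).trans ?_
    rw [Finset.mul_sum, Finset.mul_sum]
    refine Finset.sum_le_sum fun y _ => ?_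
    have h4 : α ^ k * (v y + (∑ x, P y x * h x - h z) ^ 2) ≤ 2 * v y := by
      nlinarith [hbot y, mul_le_mul_of_nonneg_right hαk (hv0 y)]
    linarith [mul_le_mul_of_nonneg_left h4 (G.μ_nonneg y)]
  rw [G'.sum_rho_mul fun x x' => (h x - h x') ^ 2]
  set T := ∑ t, ∑ x, G'.μ x * ∑ b, G'.condProb t x b * (h x - h (update x t b)) ^ 2 with hT
  have hvT : 2 * ∑ y, G.μ y * v y ≤ T := by
    have h2 : ∀ y, 2 * (G.μ y * v y) ≤ ∑ t, ∑ x, ∑ b,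
        G.μ y * (P y x * anchorProb α (y t) b) * (h x - h (update x t b)) ^ 2 := by
      intro y
      have h3 := mul_le_mul_of_nonneg_left
        (efron_stein (ν := fun t => anchorProb α (y t)) (fun t b => ha t (y t) b)
          (fun t => anchorProb_sum α (y t)) h) (G.μ_nonneg y)
      have h4 : ∑ t, ∑ x, ∑ b, G.μ y * (P y x * anchorProb α (y t) b) *
          (h x - h (update x t b)) ^ 2 = G.μ y * ∑ t, ∑ x, (∏ s, anchorProb α (y s) (x s)) *
            ∑ b, anchorProb α (y t) b * (h x - h (update x t b)) ^ 2 := by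
        simp only [Finset.mul_sum, hP]
        exact Finset.sum_congr rfl fun t _ => Finset.sum_congr rfl fun x _ =>
          Finset.sum_congr rfl fun b _ => by ring
      rw [h4]
      linarith
    rw [Finset.mul_sum]
    refine (Finset.sum_le_sum fun y _ => h2 y).trans ?_
    rw [Finset.sum_comm]
    refine Finset.sum_le_sum fun t _ => ?_
    rw [Finset.sum_comm]
    refine Finset.sum_le_sum fun x _ => ?_
    rw [Finset.sum_comm, Finset.mul_sum]
    refine Finset.sum_le_sum fun b _ => ?_
    rw [← Finset.sum_mul, ← mul_assoc]
    by_cases hb : b = x t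
    · simp [hb]
    · exact mul_le_mul_of_nonneg_right (G.anchored_edge_le h0.le h1.le t x hb) (sq_nonneg _)
  rw [div_mul_eq_mul_div, div_mul_eq_mul_div, one_mul,
    div_le_div_iff₀ (by positivity) (by positivity)]
  have hle : α ^ k * V ≤ T := hVv.trans hvT
  have hT0 : 0 ≤ T := (mul_nonneg hαk0.le hV0).trans hle
  nlinarith [mul_le_mul_of_nonneg_right hle (show (0 : ℝ) ≤ k by linarith),
    mul_nonneg hT0 (show (0 : ℝ) ≤ k by linarith)]

/-! ### Connected games -/

theorem rho_symm (G : Game k X A) (x x' : ∀ t, X t) : G.rho x x' = G.rho x' x := by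
  rw [rho_eq_mixture, rho_eq_mixture]
  exact Finset.sum_congr rfl fun s _ => by ring

theorem rho_self_pos (G : Game k X A) (hk : 1 ≤ k) {x : ∀ t, X t} (hx : G.μ x ≠ 0) :
    0 < G.rho x x := by
  classical
  have hk' : (0 : ℝ) < k := by positivity
  have hx0 : 0 < G.μ x := lt_of_le_of_ne (G.μ_nonneg x) hx.symm
  have : Nonempty (Fin k) := ⟨⟨0, hk⟩⟩
  rw [rho_eq_sum]
  refine Finset.sum_pos (fun t _ => ?_) univ_nonempty
  rw [if_pos fun _ _ => rfl, condProb, update_eq_self]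
  have : 0 < G.margExcept t x :=
    lt_of_le_of_ne (G.margExcept_nonneg t x) (G.margExcept_ne_zero t hx).symm
  positivity

theorem exists_μ_ne_zero (G : Game k X A) : ∃ x, G.μ x ≠ 0 := by
  by_contra! h
  simpa [h] using G.μ_sum

theorem rhoMin_set_nonempty (G : Game k X A) (hk : 1 ≤ k) :
    {s | 0 < s ∧ ∃ a b, s = G.rho a b}.Nonempty := by
  obtain ⟨x, hx⟩ := G.exists_μ_ne_zero
  exact ⟨_, G.rho_self_pos hk hx, x, x, rfl⟩

theorem rhoMin_pos (G : Game k X A) (hk : 1 ≤ k) : 0 < G.rhoMin := by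
  have hfin : {s | 0 < s ∧ ∃ a b, s = G.rho a b}.Finite :=
    (Set.finite_range fun p : (∀ t, X t) × (∀ t, X t) => G.rho p.1 p.2).subset
      (by rintro s ⟨-, a, b, rfl⟩; exact ⟨(a, b), rfl⟩)
  exact ((G.rhoMin_set_nonempty hk).csInf_mem hfin).1

theorem rhoMin_le (G : Game k X A) {x x' : ∀ t, X t} (h : 0 < G.rho x x') :
    G.rhoMin ≤ G.rho x x' :=
  csInf_le ⟨0, fun _ hs => hs.1.le⟩ ⟨h, x, x', rfl⟩

/-- The loops of the connection graph show that it has at most `1 / ρ_min` vertices. -/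
theorem card_mul_rhoMin_le_one (G : Game k X A) (hk : 1 ≤ k) {N : Finset (∀ t, X t)}
    (hN : ∀ x ∈ N, G.μ x ≠ 0) : N.card * G.rhoMin ≤ 1 := by
  calc N.card * G.rhoMin = ∑ x ∈ N, G.rhoMin := by rw [Finset.sum_const, nsmul_eq_mul]
    _ ≤ ∑ x ∈ N, WGraph.weight G.rho x := Finset.sum_le_sum fun x hx =>
        (G.rhoMin_le (G.rho_self_pos hk (hN x hx))).trans
          (Finset.single_le_sum (f := fun y => G.rho x y) (fun y _ => G.rho_nonneg x y) (mem_univ x))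
    _ ≤ ∑ x, G.μ x := by
        simp_rw [G.weight_rho hk]
        exact Finset.sum_le_sum_of_subset_of_nonneg (subset_univ N) fun x _ _ => G.μ_nonneg x
    _ = 1 := G.μ_sum

theorem rhoMin_le_one (G : Game k X A) (hk : 1 ≤ k) : G.rhoMin ≤ 1 := by
  obtain ⟨x, hx⟩ := G.exists_μ_ne_zero
  simpa using G.card_mul_rhoMin_le_one hk (N := {x}) (by simpa using hx)

theorem _root_.SimpleGraph.Walk.sum_darts_sub {V : Type*} {H : SimpleGraph V} (h : V → ℝ) {a b : V}
    (p : H.Walk a b) : (p.darts.map fun d => h d.fst - h d.snd).sum = h a - h b := by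
  induction p with
  | nil => simp
  | cons hadj p ih => simp [ih]

/-- Cauchy–Schwarz along a path: its edges are distinct, have weight at least `ρ_min`, and number at
most `1 / ρ_min`. -/
theorem IsConnected.sq_sub_le {G : Game k X A} (hk : 1 ≤ k) (hG : G.IsConnected)
    (h : (∀ t, X t) → ℝ) {x y : ∀ t, X t} (hx : G.μ x ≠ 0) (hy : G.μ y ≠ 0) :
    G.rhoMin ^ 2 * (h x - h y) ^ 2 ≤ ∑ a, ∑ b, G.rho a b * (h a - h b) ^ 2 := by
  classical
  have hδ := G.rhoMin_pos hk
  rw [← G.weight_rho hk] at hx hy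
  obtain ⟨p, hp⟩ := (hG.preconnected ⟨x, hx⟩ ⟨y, hy⟩).exists_isPath
  have hnd : p.darts.Nodup := SimpleGraph.Walk.darts_nodup_of_support_nodup hp.support_nodup
  have hlen : (p.length : ℝ) * G.rhoMin ≤ 1 := by
    have h1 := G.card_mul_rhoMin_le_one hk (N := univ.filter fun a => WGraph.weight G.rho a ≠ 0)
      (by simp [G.weight_rho hk])
    rw [← Fintype.card_subtype] at h1
    have h2 : (p.length : ℝ) ≤ Fintype.card {a // WGraph.weight G.rho a ≠ 0} := by
      exact_mod_cast hp.length_lt.le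
    exact (mul_le_mul_of_nonneg_right h2 hδ.le).trans h1
  have hsum := p.sum_darts_sub fun a => h a.1
  rw [← List.sum_toFinset _ hnd] at hsum
  have hcs := sq_sum_le_card_mul_sum_sq (s := p.darts.toFinset)
    (f := fun d => h d.fst.1 - h d.snd.1)
  rw [hsum, List.toFinset_card_of_nodup hnd, SimpleGraph.Walk.length_darts] at hcs
  have hE : G.rhoMin * ∑ d ∈ p.darts.toFinset, (h d.fst.1 - h d.snd.1) ^ 2 ≤
      ∑ a, ∑ b, G.rho a b * (h a - h b) ^ 2 := by
    rw [Finset.mul_sum, ← Fintype.sum_prod_type']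
    calc ∑ d ∈ p.darts.toFinset, G.rhoMin * (h d.fst.1 - h d.snd.1) ^ 2
        ≤ ∑ d ∈ p.darts.toFinset, G.rho d.fst.1 d.snd.1 * (h d.fst.1 - h d.snd.1) ^ 2 := by
          refine Finset.sum_le_sum fun d _ => mul_le_mul_of_nonneg_right (G.rhoMin_le ?_) (sq_nonneg _)
          rcases ((SimpleGraph.fromRel_adj _ _ _).1 d.adj).2 with h1 | h1
          · exact h1
          · rw [rho_symm]
            exact h1
      _ = ∑ q ∈ p.darts.toFinset.image fun d => (d.fst.1, d.snd.1),
            G.rho q.1 q.2 * (h q.1 - h q.2) ^ 2 := by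
          rw [Finset.sum_image]
          intro d _ d' _ hdd
          simp only [Prod.mk.injEq] at hdd
          exact SimpleGraph.Dart.ext _ _ (Prod.ext (Subtype.ext hdd.1) (Subtype.ext hdd.2))
      _ ≤ _ := Finset.sum_le_sum_of_subset_of_nonneg (subset_univ _) fun q _ _ =>
          mul_nonneg (G.rho_nonneg _ _) (sq_nonneg _)
  set E := ∑ a, ∑ b, G.rho a b * (h a - h b) ^ 2
  set B := ∑ d ∈ p.darts.toFinset, (h d.fst.1 - h d.snd.1) ^ 2
  have hB0 : 0 ≤ B := Finset.sum_nonneg fun d _ => sq_nonneg _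
  calc G.rhoMin ^ 2 * (h x - h y) ^ 2 ≤ G.rhoMin ^ 2 * (p.length * B) :=
        mul_le_mul_of_nonneg_left hcs (by positivity)
    _ = (p.length * G.rhoMin) * (G.rhoMin * B) := by ring
    _ ≤ 1 * (G.rhoMin * B) := mul_le_mul_of_nonneg_right hlen (by positivity)
    _ ≤ E := by rw [one_mul]; exact hE

theorem IsConnected.poincare {G : Game k X A} (hk : 1 ≤ k) (hG : G.IsConnected) :
    G.Poincare G.rho (G.rhoMin ^ 2) := by
  intro h
  rw [sum_mul_sub_mean_sq_eq G.μ_sum]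
  set E := ∑ a, ∑ b, G.rho a b * (h a - h b) ^ 2 with hE
  have hE0 : 0 ≤ E := Finset.sum_nonneg fun a _ => Finset.sum_nonneg fun b _ =>
    mul_nonneg (G.rho_nonneg a b) (sq_nonneg _)
  have h1 : G.rhoMin ^ 2 * ∑ x, ∑ y, G.μ x * (G.μ y * (h x - h y) ^ 2) ≤
      ∑ x, ∑ y, G.μ x * (G.μ y * E) := by
    simp only [Finset.mul_sum]
    refine Finset.sum_le_sum fun x _ => Finset.sum_le_sum fun y _ => ?_
    by_cases hx : G.μ x = 0
    · simp [hx]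
    by_cases hy : G.μ y = 0
    · simp [hy]
    have h2 := mul_le_mul_of_nonneg_left (hG.sq_sub_le hk h hx hy)
      (mul_nonneg (G.μ_nonneg x) (G.μ_nonneg y))
    linarith
  have h3 : ∑ x, ∑ y, G.μ x * (G.μ y * E) = E := by
    simp_rw [← Finset.mul_sum, ← Finset.sum_mul, G.μ_sum, one_mul]
  rw [h3] at h1
  linarith

/-! ### Uniform question distributions -/

theorem margExcept_le_one (G : Game k X A) (t : Fin k) (x : ∀ t, X t) : G.margExcept t x ≤ 1 := by
  classical
  rw [margExcept, ← sum_ite_agree t x G.μ, ← G.μ_sum]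
  refine Finset.sum_le_sum fun z _ => ?_
  split_ifs
  exacts [le_rfl, G.μ_nonneg z]

theorem IsUniformOn.le_rhoMin {G : Game k X A} (hk : 1 ≤ k) {S : Finset (∀ t, X t)}
    (hS : G.IsUniformOn S) : 1 / ((k : ℝ) * (S.card : ℝ) ^ 2) ≤ G.rhoMin := by
  classical
  refine le_csInf (G.rhoMin_set_nonempty hk) ?_
  rintro _ ⟨hpos, x, x', rfl⟩
  rw [rho_eq_sum] at hpos ⊢
  obtain ⟨t, -, ht⟩ := Finset.exists_lt_of_sum_lt (f := fun _ => (0 : ℝ)) (by simpa using hpos)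
  refine le_trans ?_ (Finset.single_le_sum (f := fun t => if ∀ s, s ≠ t → x s = x' s then
      1 / (k : ℝ) * (G.μ x * G.condProb t x (x' t)) else 0) (fun t _ => ?_) (mem_univ t))
  swap
  · have := G.μ_nonneg x
    have := G.condProb_nonneg t x (x' t)
    split_ifs <;> positivity
  have hμ : ∀ {z}, G.μ z ≠ 0 → G.μ z = 1 / (S.card : ℝ) := fun {z} hz =>
    hS.1 z (by by_contra h; exact hz (hS.2 z h))
  split_ifs at ht with h
  · have hx : G.μ x ≠ 0 := fun h0 => by simp [h0] at ht
    have hc : G.condProb t x (x' t) ≠ 0 := fun h0 => by simp [h0] at ht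
    have hm := lt_of_le_of_ne (G.margExcept_nonneg t x) (G.margExcept_ne_zero t hx).symm
    have hu : G.μ (update x t (x' t)) ≠ 0 := fun h0 => hc (by simp [condProb, h0])
    have h1 : 1 / (S.card : ℝ) ≤ G.condProb t x (x' t) := by
      rw [condProb, hμ hu, le_div_iff₀ hm]
      exact mul_le_of_le_one_right (by positivity) (G.margExcept_le_one t x)
    rw [if_pos h, hμ hx]
    calc 1 / ((k : ℝ) * (S.card : ℝ) ^ 2) = 1 / (k : ℝ) * (1 / (S.card : ℝ) * (1 / (S.card : ℝ))) := by
          rw [one_div_mul_one_div, one_div_mul_one_div, sq]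
      _ ≤ _ := by gcongr
  · exact absurd ht (lt_irrefl 0)

end Game

theorem corollary1 :
    ∃ c : ℝ, 0 < c ∧
      ∀ (k : ℕ), 1 ≤ k →
      ∀ (X : Fin k → Type u) (A : Fin k → Type v) [∀ t, Fintype (X t)] [∀ t, Fintype (A t)],
      ∀ G : Game k X A,
        -- free games
        (G.IsFree → ∀ (ε : ℝ) (n : ℕ), 2 ≤ Fintype.card (∀ t, A t) → 0 < ε →
            G.val ≤ 1 - ε → G.LargeRep ε n →
          (G.rep n).val ≤
            Real.exp (-(c * ε ^ 5 * n / (k ^ 2 * Real.log (Fintype.card (∀ t, A t)))))) ∧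
        -- anchored games
        (∀ (α : ℝ) (h0 : 0 < α) (h1 : α < 1),
          ENNReal.ofReal (α ^ k / (8 * k)) ≤ (G.anchored α h0.le h1.le).lam ∧
          ∀ (ε : ℝ) (n : ℕ), 2 ≤ Fintype.card (∀ t, A t) → 0 < ε →
            (G.anchored α h0.le h1.le).val ≤ 1 - ε →
            (G.anchored α h0.le h1.le).LargeRep ε n →
            ((G.anchored α h0.le h1.le).rep n).val ≤
              Real.exp (-(c * α ^ (2 * k) * ε ^ 5 * n /
                (64 * k ^ 2 * Real.log (Fintype.card (∀ t, A t)))))) ∧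
        -- connected games
        (G.IsConnected → ∀ (ε : ℝ) (n : ℕ), 2 ≤ Fintype.card (∀ t, A t) → 0 < ε →
            G.val ≤ 1 - ε → G.LargeRep ε n →
          (G.rep n).val ≤
            Real.exp (-(c * G.rhoMin ^ 2 * ε ^ 5 * n /
              Real.log (Fintype.card (∀ t, A t))))) ∧
        (∀ S : Finset (∀ t, X t), G.IsUniformOn S →
          1 / ((k : ℝ) * (S.card : ℝ) ^ 2) ≤ G.rhoMin) := by
  refine ⟨1 / 640, by norm_num, fun k hk X A _ _ G => ⟨?_, ?_, ?_, ?_⟩⟩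
  · intro hG ε n hA hε hval _
    have hk' : (1 : ℝ) ≤ k := by exact_mod_cast hk
    refine (G.val_rep_le hk (by positivity) (div_le_one_of_le₀ (one_le_pow₀ hk') (by positivity))
      (hG.poincare hk) hε hval hA n).trans (le_of_eq ?_)
    congr 2
    field_simp
  · intro α h0 h1
    have hP := G.anchored_poincare hk h0 h1
    refine ⟨hP.le_lam hk, fun ε n hA hε hval _ => ?_⟩
    have hk' : (1 : ℝ) ≤ k := by exact_mod_cast hk
    have hα : α ^ k ≤ 1 := pow_le_one₀ h0.le h1.le
    have hα0 : 0 < α ^ k := pow_pos h0 k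
    set L := α ^ k / (8 * k) with hL
    have hL0 : 0 < L := by positivity
    have hL1 : L ≤ 1 := div_le_one_of_le₀ (by linarith) (by positivity)
    refine ((G.anchored α h0.le h1.le).val_rep_le hk hL0 hL1 hP hε hval hA n).trans
      (Real.exp_le_exp.2 (neg_le_neg ?_))
    set ℓ := Real.log (Fintype.card (∀ t, A t))
    have hℓ : 0 < ℓ := Real.log_pos (by exact_mod_cast hA)
    have h2 : 1 / 640 * α ^ (2 * k) * ε ^ 5 * n / (64 * k ^ 2 * ℓ) =
        ε ^ 5 * n / (640 * ℓ) * (L * L) := by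
      rw [hL, two_mul, pow_add]
      field_simp
      ring
    have h3 : ε ^ 5 * L * n / (640 * ℓ) = ε ^ 5 * n / (640 * ℓ) * L := by ring
    rw [h2, h3]
    exact mul_le_mul_of_nonneg_left (mul_le_of_le_one_left hL0.le hL1) (by positivity)
  · intro hG ε n hA hε hval _
    have hδ := G.rhoMin_pos hk
    refine (G.val_rep_le hk (by positivity) (pow_le_one₀ hδ.le (G.rhoMin_le_one hk))
      (hG.poincare hk) hε hval hA n).trans (le_of_eq ?_)
    congr 2
    have hℓ : Real.log (Fintype.card (∀ t, A t)) ≠ 0 :=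
      (Real.log_pos (by exact_mod_cast hA)).ne'
    field_simp
  · exact fun S hS => hS.le_rhoMin hk
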